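/- Let $p$ be a prime, $E$ a field of characteristic $p$, and $\mathbf{E}=E((X))$ with its $X$-adic topology, its $E$-linear Frobenius map $\varphi(f)(X)=f(X^p)$, and the action of $\mathbf{Z}_p^\times$ given by $(a\cdot f)(X)=f((1+X)^a-1)$. For $m\ge 0$ let $\mathbf{E}_m=E((X^{1/p^m}))$, on which $a\in\mathbf{Z}_p^\times$ acts by $X^{1/p^m}\mapsto(1+X^{1/p^m})^a-1$; let $\mathbf{E}_\infty=\bigcup_{m\ge0}\mathbf{E}_m$, and let $\widetilde{\mathbf{E}}$ be the $X$-adic completion of $\mathbf{E}_\infty$, with the valuation $\mathrm{val}_X$ and the action of $\mathbf{Z}_p^\times$ extended by continuity. Let $k\ge1$ (and $k\ge2$ if $p=2$), let $\Gamma_k=1+p^k\mathbf{Z}_p$, and let $c:\Gamma_k\to\mathbf{Z}_p$ be the coordinate $1+p^kz\mapsto z$. If $N$ is an abelian group with a valuation $\mathrm{val}_N$ and an additive action of $\Gamma_k$, and $\lambda\in\mathbf{R}$, let $N^{\Gamma_k\text{-sh},\lambda}$ be the set of $x\in N$ for which there exists $\mu\in\mathbf{R}$ such that $\mathrm{val}_N\big(c^{-1}(y)\cdot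 x-c^{-1}(z)\cdot x\big)\ge p^\lambda p^i+\mu$ for all $i\ge0$ and all $y,z\in\mathbf{Z}_p$ with $y-z\in p^i\mathbf{Z}_p$; let $N^{\mathrm{sh}}=\bigcup_{\lambda\in\mathbf{R}}N^{\Gamma_k\text{-sh},\lambda}$. Let $M$ be a finite-dimensional $\mathbf{E}$-vector space with a continuous semilinear action of $\Gamma_k$, and let $\Gamma_k$ act on $\widetilde{\mathbf{E}}\otimes_{\mathbf{E}}M$ by $g(x\otimes y)=g(x)\otimes g(y)$. Call a basis $b$ of $M$ good if the $E[[X]]$-lattice that it generates is stable under $\Gamma_k$. A basis $b$ defines valuations on $M$ and on $\widetilde{\mathbf{E}}\otimes_{\mathbf{E}}M$, namely the minimum of the $X$-adic valuations of the coordinates in the basis $b$, resp. $1\otimes b$. Then $M$ has a good basis, and for every good basis of $M$, with the sets $M^{\Gamma_k\text{-sh},\lambda}$, $M^{\mathrm{sh}}$, $(\widetilde{\mathbf{E}}\otimes_{\mathbf{E}}M)^{\Gamma_k\text{-sh},\lambda}$ and $(\widetilde{\mathbf{E}}\otimes_{\mathbf{E}}M)^{\mathrm{sh}}$ defined by the corresponding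 valuations, the following hold. 1. Suppose that $M=M^{\mathrm{sh}}$. There exists an integer $m_0\ge0$ such that $M=M^{\Gamma_k\text{-sh},k-m_0}$. For every such $m_0$ and every integer $m\ge m_0$, we have $(\widetilde{\mathbf{E}}\otimes_{\mathbf{E}}M)^{\Gamma_k\text{-sh},k-m}=\mathbf{E}_m\otimes_{\mathbf{E}}M$. Moreover, $(\widetilde{\mathbf{E}}\otimes_{\mathbf{E}}M)^{\mathrm{sh}}=\mathbf{E}_\infty\otimes_{\mathbf{E}}M$. 2. Suppose that $M=\mathbf{D}$ is a $(\varphi,\Gamma)$-module over $\mathbf{E}$, that is, $M$ has in addition a $\varphi$-semilinear map $\varphi_M:M\to M$ that commutes with $\Gamma_k$ and whose matrix in any basis of $M$ is invertible. Then $(\widetilde{\mathbf{E}}\otimes_{\mathbf{E}}\mathbf{D})^{\Gamma_k\text{-sh},k-m}=\mathbf{E}_m\otimes_{\mathbf{E}}\mathbf{D}$ for all integers $m\ge0$, and hence $(\widetilde{\mathbf{E}}\otimes_{\mathbf{E}}\mathbf{D})^{\mathrm{sh}}=\mathbf{E}_\infty\otimes_{\mathbf{E}}\mathbf{D}$. 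-/

import Mathlib

open scoped LaurentSeries TensorProduct

noncomputable section

namespace SuperHolder

/-! ### The field `𝐄 = E((X))` with its Frobenius map and the action of `ℤ_p^×` -/

section Laurent

variable (p : ℕ) [Fact p.Prime] (E : Type*) [Field E]

/-- The `E`-linear Frobenius map `f(X) ↦ f(X^p)` of `E((X))`. -/
def phi : E⸨X⸩ →+* E⸨X⸩ :=
  HahnSeries.embDomainRingHom (AddMonoidHom.mulLeft (p : ℤ))
    (mul_right_injective₀ (by exact_mod_cast (Fact.out : p.Prime).ne_zero))
    (fun _ _ => mul_le_mul_iff_right₀ (by exact_mod_cast (Fact.out : p.Prime).pos))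

/-- The map `E((X)) → E((X^{1/p^n}))`, `f(X) ↦ f(X^{1/p^n})`, the target being seen inside the
field of Hahn series in `X` with exponents in `ℚ`. -/
def emb (n : ℕ) : E⸨X⸩ →+* HahnSeries ℚ E :=
  HahnSeries.embDomainRingHom
    ((AddMonoidHom.mulLeft (((p : ℚ) ^ n)⁻¹)).comp (Int.castAddHom ℚ))
    (fun a b h => by
      have h0 : ((p : ℚ) ^ n)⁻¹ ≠ 0 :=
        inv_ne_zero (pow_ne_zero _ (by exact_mod_cast (Fact.out : p.Prime).ne_zero))
      have := mul_right_injective₀ h0 h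
      exact Int.cast_injective (α := ℚ) this)
    (fun a b => by
      have h0 : (0 : ℚ) < ((p : ℚ) ^ n)⁻¹ :=
        inv_pos.2 (pow_pos (by exact_mod_cast (Fact.out : p.Prime).pos) _)
      simp [mul_le_mul_iff_right₀ h0])

theorem phi_coeff_mul (f : E⸨X⸩) (m : ℤ) : (phi p E f).coeff (p * m) = f.coeff m :=
  HahnSeries.embDomain_coeff (f := ⟨⟨_, _⟩, _⟩) (a := m)

theorem phi_coeff_of_not_dvd (f : E⸨X⸩) {m : ℤ} (h : ¬ (p : ℤ) ∣ m) : (phi p E f).coeff m = 0 :=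
  HahnSeries.embDomain_of_notMem_range (by
    rintro ⟨j, hj⟩
    exact h ⟨j, hj.symm⟩)

theorem emb_coeff_div (n : ℕ) (f : E⸨X⸩) (m : ℤ) :
    (emb p E n f).coeff (((p : ℚ) ^ n)⁻¹ * m) = f.coeff m :=
  HahnSeries.embDomain_coeff (f := ⟨⟨_, _⟩, _⟩) (a := m)

theorem emb_coeff_of_forall_ne (n : ℕ) (f : E⸨X⸩) {q : ℚ}
    (h : ∀ m : ℤ, ((p : ℚ) ^ n)⁻¹ * m ≠ q) : (emb p E n f).coeff q = 0 :=
  HahnSeries.embDomain_of_notMem_range (by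
    rintro ⟨j, hj⟩
    exact h j hj)

theorem emb_phi (n : ℕ) (f : E⸨X⸩) : emb p E (n + 1) (phi p E f) = emb p E n f := by
  have hp : (p : ℚ) ≠ 0 := by exact_mod_cast (Fact.out : p.Prime).ne_zero
  ext q
  by_cases h : ∃ m : ℤ, ((p : ℚ) ^ (n + 1))⁻¹ * m = q
  · obtain ⟨m, rfl⟩ := h
    rw [emb_coeff_div]
    by_cases h : (p : ℤ) ∣ m
    · obtain ⟨j, rfl⟩ := h
      have : ((p : ℚ) ^ (n + 1))⁻¹ * ((p * j : ℤ) : ℚ) = ((p : ℚ) ^ n)⁻¹ * j := by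
        push_cast; field_simp; ring
      rw [phi_coeff_mul, this, emb_coeff_div]
    · rw [phi_coeff_of_not_dvd p E f h, emb_coeff_of_forall_ne]
      intro j hj
      apply h
      refine ⟨j, ?_⟩
      rw [pow_succ] at hj
      field_simp at hj
      rw [mul_comm] at hj
      exact_mod_cast hj.symm
  · rw [emb_coeff_of_forall_ne, emb_coeff_of_forall_ne]
    · intro m hm
      refine h ⟨p * m, ?_⟩
      rw [← hm]
      push_cast; field_simp; ring
    · exact fun m hm => h ⟨m, hm⟩

theorem emb_phi_iterate (n j : ℕ) (f : E⸨X⸩) : emb p E (n + j) ((phi p E)^[j] f) = emb p E n f := by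
  induction j with
  | zero => rfl
  | succ j ih => rw [← add_assoc, Function.iterate_succ_apply', emb_phi, ih]

theorem phi_coe (f : PowerSeries E) :
    phi p E (HahnSeries.ofPowerSeries ℤ E f)
      = HahnSeries.ofPowerSeries ℤ E (f.expand p (Fact.out : p.Prime).ne_zero) := by
  have hp : (p : ℤ) ≠ 0 := by exact_mod_cast (Fact.out : p.Prime).ne_zero
  have hp' : (0 : ℤ) < p := by exact_mod_cast (Fact.out : p.Prime).pos
  ext n
  rw [PowerSeries.coeff_coe]
  by_cases h : (p : ℤ) ∣ n
  · obtain ⟨m, rfl⟩ := h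
    rw [phi_coeff_mul, PowerSeries.coeff_coe]
    by_cases hm : m < 0
    · rw [if_pos hm, if_pos (mul_neg_of_pos_of_neg hp' hm)]
    · rw [if_neg hm, if_neg (not_lt.2 (mul_nonneg hp'.le (not_lt.1 hm))), Int.natAbs_mul,
        Int.natAbs_natCast, PowerSeries.coeff_expand_mul]
  · rw [phi_coeff_of_not_dvd p E _ h, PowerSeries.coeff_expand_of_not_dvd, ite_self]
    rwa [← Int.natCast_dvd]

variable [CharP E p]

/-- The ring homomorphism `ℤ_p → 𝔽_p → E`. -/
def resE : ℤ_[p] →+* E := (ZMod.castHom (dvd_refl p) E).comp PadicInt.toZMod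

/-- The power series `(1+X)^a = ∑ₙ (a choose n) X^n` with coefficients in `E`, for `a ∈ ℤ_p`. -/
def onePlusXPow (a : ℤ_[p]) : PowerSeries E := PowerSeries.mk fun n => resE p E (Ring.choose a n)

/-- The power series `(1+X)^a - 1`. -/
def gam (a : ℤ_[p]) : PowerSeries E := onePlusXPow p E a - 1

theorem gam_constCoeff (a : ℤ_[p]) : (gam p E a).constantCoeff = 0 := by
  rw [← PowerSeries.coeff_zero_eq_constantCoeff_apply]
  simp [gam, onePlusXPow, -PowerSeries.coeff_zero_eq_constantCoeff]

theorem gam_hasSubst (a : ℤ_[p]) : PowerSeries.HasSubst (gam p E a) :=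
  PowerSeries.HasSubst.of_constantCoeff_zero' (gam_constCoeff p E a)

theorem gam_coeff_one (a : ℤ_[p]ˣ) : (gam p E (a : ℤ_[p])).coeff 1 ≠ 0 := by
  have : (gam p E (a : ℤ_[p])).coeff 1 = resE p E a := by
    simp [gam, onePlusXPow, PowerSeries.coeff_one]
  rw [this]
  exact (a.isUnit.map (resE p E)).ne_zero

theorem gam_ne_zero (a : ℤ_[p]ˣ) : gam p E (a : ℤ_[p]) ≠ 0 := fun h =>
  gam_coeff_one p E a (by simp [h])

/-- The automorphism `f(X) ↦ f((1+X)^a - 1)` of `E((X))`, for `a ∈ ℤ_p^×`: it is the substitution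
on `E[[X]]`, extended to the localization `E((X)) = E[[X]][1/X]`. -/
def sigma (a : ℤ_[p]ˣ) : E⸨X⸩ →+* E⸨X⸩ :=
  IsLocalization.Away.lift (PowerSeries.X : PowerSeries E)
    (g := (HahnSeries.ofPowerSeries ℤ E).comp
      (PowerSeries.substAlgHom (R := E) (gam_hasSubst p E a)).toRingHom)
    (by
      rw [isUnit_iff_ne_zero]
      have h : PowerSeries.substAlgHom (R := E) (gam_hasSubst p E a) (PowerSeries.X : PowerSeries E)
          = gam p E a := PowerSeries.substAlgHom_X _
      change HahnSeries.ofPowerSeries ℤ E (PowerSeries.substAlgHom (R := E) (gam_hasSubst p E a)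
        (PowerSeries.X : PowerSeries E)) ≠ 0
      rw [h]
      exact (map_ne_zero_iff _ HahnSeries.ofPowerSeries_injective).2 (gam_ne_zero p E a))

theorem sigma_coe (a : ℤ_[p]ˣ) (f : PowerSeries E) :
    sigma p E a (HahnSeries.ofPowerSeries ℤ E f)
      = HahnSeries.ofPowerSeries ℤ E (f.subst (gam p E (a : ℤ_[p]))) := by
  have := IsLocalization.Away.lift_eq (S := E⸨X⸩) (PowerSeries.X : PowerSeries E)
    (g := (HahnSeries.ofPowerSeries ℤ E).comp
      (PowerSeries.substAlgHom (R := E) (gam_hasSubst p E a)).toRingHom)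
    (by
      rw [isUnit_iff_ne_zero]
      have h : PowerSeries.substAlgHom (R := E) (gam_hasSubst p E a) (PowerSeries.X : PowerSeries E)
          = gam p E a := PowerSeries.substAlgHom_X _
      change HahnSeries.ofPowerSeries ℤ E (PowerSeries.substAlgHom (R := E) (gam_hasSubst p E a)
        (PowerSeries.X : PowerSeries E)) ≠ 0
      rw [h]
      exact (map_ne_zero_iff _ HahnSeries.ofPowerSeries_injective).2 (gam_ne_zero p E a)) f
  rw [← PowerSeries.coe_substAlgHom (gam_hasSubst p E a)]
  exact this

theorem resE_pow (x : ℤ_[p]) : resE p E x ^ p = resE p E x := by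
  simp only [resE, RingHom.comp_apply]
  rw [← map_pow, ZMod.pow_card]

theorem expand_onePlusXPow (a : ℤ_[p]) :
    (onePlusXPow p E a).expand p (Fact.out : p.Prime).ne_zero = onePlusXPow p E a ^ p := by
  have hp : p ≠ 0 := (Fact.out : p.Prime).ne_zero
  have : ExpChar E p := ExpChar.prime Fact.out
  have h := MvPowerSeries.map_frobenius_expand (σ := Unit) (R := E) p hp (f := onePlusXPow p E a)
  refine Eq.trans ?_ h
  have h2 : PowerSeries.map (frobenius E p) (onePlusXPow p E a) = onePlusXPow p E a := by
    ext n
    simp [onePlusXPow, frobenius_def, resE_pow]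
  change _ = PowerSeries.map (frobenius E p) ((onePlusXPow p E a).expand p hp)
  rw [PowerSeries.map_expand, h2]

theorem expand_gam (a : ℤ_[p]) :
    (gam p E a).expand p (Fact.out : p.Prime).ne_zero = gam p E a ^ p := by
  have : ExpChar E p := ExpChar.prime Fact.out
  have : ExpChar (PowerSeries E) p := by
    have : CharP (PowerSeries E) p := charP_of_injective_ringHom
      (f := (PowerSeries.C : E →+* PowerSeries E)) PowerSeries.C_injective p
    exact ExpChar.prime Fact.out
  rw [gam, map_sub, map_one, expand_onePlusXPow, sub_pow_expChar, one_pow]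

theorem sigma_phi (a : ℤ_[p]ˣ) (f : E⸨X⸩) : sigma p E a (phi p E f) = phi p E (sigma p E a f) := by
  have hs := gam_hasSubst p E (a : ℤ_[p])
  have hp : p ≠ 0 := (Fact.out : p.Prime).ne_zero
  suffices h : (sigma p E a).comp (phi p E) = (phi p E).comp (sigma p E a) from
    DFunLike.congr_fun h f
  refine IsLocalization.ringHom_ext (Submonoid.powers (PowerSeries.X : PowerSeries E)) ?_
  ext1 g
  change sigma p E a (phi p E (HahnSeries.ofPowerSeries ℤ E g))
    = phi p E (sigma p E a (HahnSeries.ofPowerSeries ℤ E g))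
  rw [phi_coe, sigma_coe, sigma_coe, phi_coe, PowerSeries.expand_apply]
  congr 1
  rw [PowerSeries.subst_comp_subst_apply (PowerSeries.HasSubst.X_pow hp) hs,
    PowerSeries.subst_pow hs, PowerSeries.subst_X hs, ← expand_gam]
  exact (PowerSeries.expand_subst p hp hs g).symm

theorem sigma_phi_iterate (a : ℤ_[p]ˣ) (j : ℕ) (f : E⸨X⸩) :
    sigma p E a ((phi p E)^[j] f) = (phi p E)^[j] (sigma p E a f) := by
  induction j with
  | zero => rfl
  | succ j ih => rw [Function.iterate_succ_apply', sigma_phi, ih, ← Function.iterate_succ_apply' (phi p E)]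

/-- Substitution does not decrease the `X`-adic valuation. -/
theorem sigma_coeff_eq_zero (a : ℤ_[p]ˣ) (d : ℤ) (f : E⸨X⸩) (hf : ∀ j < d, f.coeff j = 0) :
    ∀ j < d, (sigma p E a f).coeff j = 0 := by
  -- write `f = X ^ d * g` and `σ X = X * w` with `g` in `E[[X]]` and `w` in `E[[X]]ˣ`
  have key : ∀ h : E⸨X⸩, (∀ j < d, h.coeff j = 0) ↔
      ∃ g : PowerSeries E, h = HahnSeries.single (1 : ℤ) (1 : E) ^ d *
        HahnSeries.ofPowerSeries ℤ E g := by
    have hsd : (HahnSeries.single (1 : ℤ) (1 : E)) ^ d = HahnSeries.single d 1 := by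
      exact (RatFunc.single_zpow d).symm
    intro h
    constructor
    · intro hh
      refine ⟨PowerSeries.mk fun n => h.coeff (d + n), ?_⟩
      rw [hsd]
      ext j
      rw [show j = (j - d) + d by ring, HahnSeries.coeff_single_mul_add, one_mul,
        PowerSeries.coeff_coe]
      split_ifs with hj
      · exact hh _ (by omega)
      · rw [PowerSeries.coeff_mk]
        congr 1
        omega
    · rintro ⟨g, rfl⟩ j hj
      rw [hsd, show j = (j - d) + d by ring, HahnSeries.coeff_single_mul_add, one_mul,
        PowerSeries.coeff_coe, if_pos (by omega)]
  obtain ⟨g, rfl⟩ := (key f).1 hf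
  rw [key]
  obtain ⟨w, hw⟩ : ∃ w : PowerSeries E, gam p E (a : ℤ_[p]) = PowerSeries.X * w :=
    PowerSeries.X_dvd_iff.2 (gam_constCoeff p E a)
  have hwu : IsUnit w := by
    rw [PowerSeries.isUnit_iff_constantCoeff, isUnit_iff_ne_zero]
    have := gam_coeff_one p E a
    rw [hw, show (1 : ℕ) = 0 + 1 from rfl, PowerSeries.coeff_succ_X_mul] at this
    simpa using this
  obtain ⟨u, rfl⟩ := hwu
  have hX : sigma p E a (HahnSeries.single (1 : ℤ) (1 : E)) =
      HahnSeries.single (1 : ℤ) (1 : E) * HahnSeries.ofPowerSeries ℤ E u := by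
    rw [← HahnSeries.ofPowerSeries_X, sigma_coe, PowerSeries.subst_X (gam_hasSubst p E _), hw,
      map_mul]
  refine ⟨((u ^ d : (PowerSeries E)ˣ) : PowerSeries E) * g.subst (gam p E (a : ℤ_[p])), ?_⟩
  have hu : (HahnSeries.ofPowerSeries ℤ E u) ^ d
      = HahnSeries.ofPowerSeries ℤ E ((u ^ d : (PowerSeries E)ˣ) : PowerSeries E) := by
    have := map_zpow (Units.map (HahnSeries.ofPowerSeries ℤ E : _ →* E⸨X⸩)) u d
    have h2 := congrArg (fun x : (E⸨X⸩)ˣ => (x : E⸨X⸩)) this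
    rw [Units.val_zpow_eq_zpow_val] at h2
    exact h2.symm
  rw [map_mul, map_zpow₀, hX, mul_zpow, sigma_coe, hu, map_mul, mul_assoc]

end Laurent

/-! ### The completion `Ẽ` -/

section Hahn

variable {E : Type*} [Field E]

/-- `VG c f` says that the `X`-adic valuation of `f` is at least `c`. -/
def VG (c : ℚ) (f : HahnSeries ℚ E) : Prop := (c : WithTop ℚ) ≤ f.orderTop

theorem VG_iff {c : ℚ} {f : HahnSeries ℚ E} : VG c f ↔ ∀ q < c, f.coeff q = 0 := by
  simp [VG, HahnSeries.le_orderTop_iff_forall]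

theorem VG.mono {c d : ℚ} {f : HahnSeries ℚ E} (h : VG d f) (hcd : c ≤ d) : VG c f :=
  le_trans (WithTop.coe_le_coe.2 hcd) h

theorem VG.add {c : ℚ} {f g : HahnSeries ℚ E} (hf : VG c f) (hg : VG c g) : VG c (f + g) :=
  le_trans (le_min hf hg) HahnSeries.min_orderTop_le_orderTop_add

theorem VG.neg {c : ℚ} {f : HahnSeries ℚ E} (hf : VG c f) : VG c (-f) := by
  rw [VG_iff] at *
  intro q hq
  simp [hf q hq]

theorem VG.sub {c : ℚ} {f g : HahnSeries ℚ E} (hf : VG c f) (hg : VG c g) : VG c (f - g) := by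
  rw [sub_eq_add_neg]; exact hf.add hg.neg

theorem VG.mul {c d : ℚ} {f g : HahnSeries ℚ E} (hf : VG c f) (hg : VG d g) :
    VG (c + d) (f * g) := by
  unfold VG at *
  rw [HahnSeries.orderTop_mul, WithTop.coe_add]
  exact add_le_add hf hg

theorem exists_VG (f : HahnSeries ℚ E) : ∃ c ≤ 0, VG c f := by
  by_cases h : f = 0
  · exact ⟨0, le_rfl, by simp [VG, h]⟩
  · exact ⟨min 0 f.order, min_le_left _ _, VG.mono (d := f.order)
      (by rw [VG, HahnSeries.order_eq_orderTop_of_ne_zero h]) (min_le_right _ _)⟩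

theorem eq_zero_of_VG {f : HahnSeries ℚ E} (h : ∀ c, VG c f) : f = 0 := by
  ext q
  exact VG_iff.1 (h (q + 1)) q (by linarith)

theorem VG_zero (c : ℚ) : VG c (0 : HahnSeries ℚ E) := by simp [VG]

theorem VG.inv_sub_inv {c : ℚ} {f y : HahnSeries ℚ E} (hf : f ≠ 0) (hc : f.order < c)
    (h : VG c (f - y)) : VG (c - 2 * f.order) (f⁻¹ - y⁻¹) := by
  have hof : f.orderTop = (f.order : WithTop ℚ) := (HahnSeries.order_eq_orderTop_of_ne_zero hf).symm
  have hoy : y.orderTop = (f.order : WithTop ℚ) := by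
    have h1 : VG f.order y := by
      have := (show VG f.order f from hof.ge).sub (h.mono hc.le)
      simpa using this
    refine le_antisymm ?_ h1
    apply HahnSeries.orderTop_le_of_coeff_ne_zero
    have h2 := VG_iff.1 h _ hc
    have h3 : f.coeff f.order ≠ 0 := HahnSeries.coeff_orderTop_ne hof
    rw [HahnSeries.coeff_sub, sub_eq_zero] at h2
    rwa [← h2]
  have hinv : ∀ z : HahnSeries ℚ E, z.orderTop = (f.order : WithTop ℚ) →
      z ≠ 0 ∧ VG (-f.order) z⁻¹ := by
    intro z hz
    have hz0 : z ≠ 0 := by rintro rfl; simp at hz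
    refine ⟨hz0, ?_⟩
    have h1 := HahnSeries.orderTop_mul z z⁻¹
    rw [mul_inv_cancel₀ hz0, HahnSeries.orderTop_one, hz,
      ← HahnSeries.order_eq_orderTop_of_ne_zero (inv_ne_zero hz0), ← WithTop.coe_add,
      ← WithTop.coe_zero, WithTop.coe_inj] at h1
    rw [VG, ← HahnSeries.order_eq_orderTop_of_ne_zero (inv_ne_zero hz0), WithTop.coe_le_coe]
    linarith
  obtain ⟨hy0, hy⟩ := hinv y hoy
  obtain ⟨-, hf'⟩ := hinv f hof
  have : f⁻¹ - y⁻¹ = -((f - y) * f⁻¹ * y⁻¹) := by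
    field_simp
    ring
  rw [this]
  exact (((h.mul hf').mul hy).mono (by linarith)).neg

theorem VG.mul_sub_mul {c A B : ℚ} {f g y z : HahnSeries ℚ E} (hA : VG A f) (hB : VG B g)
    (hAc : A ≤ 0) (hBc : B ≤ 0) (hy : VG (max c 0 - B - A) (f - y))
    (hz : VG (max c 0 - B - A) (g - z)) : VG c (f * g - y * z) := by
  have hc := le_max_left c 0
  have hc0 := le_max_right c 0
  have h2 : VG B z := by
    have := hB.sub (hz.mono (c := B) (by linarith))
    simpa using this
  have : f * g - y * z = f * (g - z) + (f - y) * z := by ring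
  rw [this]
  exact ((hA.mul hz).mono (by linarith)).add ((hy.mul h2).mono (by linarith))

/-- The field of Hahn series is `X`-adically complete. -/
theorem exists_limit (H : ℚ → HahnSeries ℚ E) (hH : ∀ c d, c ≤ d → VG c (H c - H d)) :
    ∃ h, ∀ c, VG c (h - H c) := by
  have hco : ∀ c d q, q < c → q < d → (H c).coeff q = (H d).coeff q := by
    have main : ∀ c d q, c ≤ d → q < c → (H c).coeff q = (H d).coeff q := by
      intro c d q hcd hq
      have := VG_iff.1 (hH c d hcd) q hq
      rwa [HahnSeries.coeff_sub, sub_eq_zero] at this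
    intro c d q hc hd
    rcases le_total c d with h | h
    · exact main c d q h hc
    · exact (main d c q h hd).symm
  have hpwo : (Function.support fun q => (H (q + 1)).coeff q).IsPWO := by
    rw [Set.isPWO_iff_isWF, Set.isWF_iff_no_descending_seq]
    intro s hs hmem
    have hw := (H (s 0 + 1)).isWF_support
    rw [Set.isWF_iff_no_descending_seq] at hw
    refine hw s hs fun i => ?_
    have h1 : s i ≤ s 0 := hs.antitone (Nat.zero_le i)
    have h2 : (H (s i + 1)).coeff (s i) ≠ 0 := hmem i
    rw [HahnSeries.mem_support, hco (s 0 + 1) (s i + 1) (s i) (by linarith) (by linarith)]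
    exact h2
  refine ⟨⟨_, hpwo⟩, fun c => ?_⟩
  rw [VG_iff]
  intro q hq
  rw [HahnSeries.coeff_sub, sub_eq_zero]
  exact hco (q + 1) c q (by linarith) hq

variable (p : ℕ) [Fact p.Prime]

theorem VG_emb {c : ℚ} {n : ℕ} {f : E⸨X⸩} :
    VG c (emb p E n f) ↔ ∀ j < ⌈c * (p : ℚ) ^ n⌉, f.coeff j = 0 := by
  have h0 : (0 : ℚ) < (p : ℚ) ^ n := pow_pos (by exact_mod_cast (Fact.out : p.Prime).pos) _
  rw [VG_iff]
  constructor
  · intro h j hj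
    rw [← emb_coeff_div p E n f j]
    apply h
    rw [Int.lt_ceil] at hj
    rwa [inv_mul_lt_iff₀ h0, mul_comm]
  · intro h q hq
    by_cases hj : ∃ m : ℤ, ((p : ℚ) ^ n)⁻¹ * m = q
    · obtain ⟨j, rfl⟩ := hj
      rw [emb_coeff_div]
      apply h
      rw [Int.lt_ceil]
      rwa [inv_mul_lt_iff₀ h0, mul_comm] at hq
    · exact emb_coeff_of_forall_ne p E n f fun m hm => hj ⟨m, hm⟩

theorem emb_common (n n' : ℕ) (y y' : E⸨X⸩) : ∃ (N j j' : ℕ),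
    emb p E n y = emb p E N ((phi p E)^[j] y) ∧ emb p E n' y' = emb p E N ((phi p E)^[j'] y') ∧
      N = n + j ∧ N = n' + j' := by
  refine ⟨n + n', n', n, ?_, ?_, rfl, add_comm _ _⟩
  · rw [emb_phi_iterate]
  · rw [add_comm n n', emb_phi_iterate]

end Hahn

section Tilde

variable (p : ℕ) [Fact p.Prime] (E : Type*) [Field E]

/-- The field `Ẽ`: the `X`-adic completion of `𝐄_∞ = ⋃ₙ E((X^{1/p^n}))`, realized as the set of
`X`-adic limits of elements of `𝐄_∞` inside the field of Hahn series with exponents in `ℚ` (in which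
`X`-adic Cauchy sequences converge). -/
def Etilde : Subfield (HahnSeries ℚ E) where
  carrier := {f | ∀ c : ℚ, ∃ (n : ℕ) (y : E⸨X⸩), VG c (f - emb p E n y)}
  zero_mem' c := ⟨0, 0, by simp [VG_zero]⟩
  one_mem' c := ⟨0, 1, by simp [VG_zero]⟩
  add_mem' {f g} hf hg c := by
    obtain ⟨n, y, hy⟩ := hf c
    obtain ⟨n', y', hy'⟩ := hg c
    obtain ⟨N, j, j', e, e', -⟩ := emb_common p n n' y y'
    refine ⟨N, (phi p E)^[j] y + (phi p E)^[j'] y', ?_⟩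
    rw [map_add, ← e, ← e', add_sub_add_comm]
    exact hy.add hy'
  neg_mem' {f} hf c := by
    obtain ⟨n, y, hy⟩ := hf c
    refine ⟨n, -y, ?_⟩
    rw [map_neg, ← neg_sub']
    exact hy.neg
  mul_mem' {f g} hf hg c := by
    obtain ⟨A, hA0, hA⟩ := exists_VG f
    obtain ⟨B, hB0, hB⟩ := exists_VG g
    obtain ⟨n, y, hy⟩ := hf (max c 0 - B)
    obtain ⟨n', y', hy'⟩ := hg (max c 0 - A)
    obtain ⟨N, j, j', e, e', -⟩ := emb_common p n n' y y'
    refine ⟨N, (phi p E)^[j] y * (phi p E)^[j'] y', ?_⟩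
    rw [map_mul, ← e, ← e']
    have hc := le_max_left c 0
    have hc0 := le_max_right c 0
    have h2 : VG B (emb p E n' y') := by
      have := hB.sub (hy'.mono (c := B) (by linarith))
      simpa using this
    have : f * g - emb p E n y * emb p E n' y'
        = f * (g - emb p E n' y') + (f - emb p E n y) * emb p E n' y' := by ring
    rw [this]
    exact ((hA.mul hy').mono (by linarith)).add ((hy.mul h2).mono (by linarith))
  inv_mem' f hf c := by
    by_cases h0 : f = 0
    · exact ⟨0, 0, by simp [h0, VG_zero]⟩
    · obtain ⟨n, y, hy⟩ := hf (max (c + 2 * f.order) (f.order + 1))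
      have := le_max_left (c + 2 * f.order) (f.order + 1)
      have := le_max_right (c + 2 * f.order) (f.order + 1)
      refine ⟨n, y⁻¹, ?_⟩
      rw [map_inv₀]
      exact (hy.inv_sub_inv h0 (by linarith)).mono (by linarith)

theorem emb_mem (n : ℕ) (y : E⸨X⸩) : emb p E n y ∈ Etilde p E := fun c =>
  ⟨n, y, by simp [VG_zero]⟩

/-- `Ẽ` is an `𝐄`-algebra. -/
instance : Algebra E⸨X⸩ (Etilde p E) :=
  ((emb p E 0).codRestrict (Etilde p E) (emb_mem p E 0)).toAlgebra

theorem algebraMap_val (f : E⸨X⸩) :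
    ((algebraMap E⸨X⸩ (Etilde p E) f : Etilde p E) : HahnSeries ℚ E) = emb p E 0 f := rfl

/-- The subfield `𝐄_m = E((X^{1/p^m}))` of `Ẽ`, as an `𝐄`-subspace. -/
def Elevel (m : ℕ) : Submodule E⸨X⸩ (Etilde p E) where
  carrier := {x | ∃ y : E⸨X⸩, emb p E m y = x}
  zero_mem' := ⟨0, map_zero _⟩
  add_mem' := by
    rintro _ _ ⟨y, hy⟩ ⟨y', hy'⟩
    exact ⟨y + y', by rw [map_add, hy, hy']; rfl⟩
  smul_mem' := by
    rintro f _ ⟨y, hy⟩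
    refine ⟨(phi p E)^[m] f * y, ?_⟩
    rw [map_mul, hy, Algebra.smul_def]
    have := emb_phi_iterate p E 0 m f
    rw [zero_add] at this
    rw [this]
    rfl

/-- The subfield `𝐄_∞ = ⋃ₘ E((X^{1/p^m}))` of `Ẽ`, as an `𝐄`-subspace. -/
def Einfty : Submodule E⸨X⸩ (Etilde p E) where
  carrier := {x | ∃ m, x ∈ Elevel p E m}
  zero_mem' := ⟨0, zero_mem _⟩
  add_mem' := by
    rintro x x' ⟨n, y, hy⟩ ⟨n', y', hy'⟩
    obtain ⟨N, j, j', e, e', -⟩ := emb_common p n n' y y'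
    refine ⟨N, add_mem ?_ ?_⟩
    · exact ⟨_, by rw [← hy, e]⟩
    · exact ⟨_, by rw [← hy', e']⟩
  smul_mem' := fun f x ⟨m, hx⟩ => ⟨m, Submodule.smul_mem _ f hx⟩

/-! ### The action of `ℤ_p^×` on `Ẽ` -/

variable [CharP E p]

theorem VG_emb_sigma (a : ℤ_[p]ˣ) {c : ℚ} {n : ℕ} {f : E⸨X⸩} (h : VG c (emb p E n f)) :
    VG c (emb p E n (sigma p E a f)) := by
  rw [VG_emb] at *
  exact sigma_coeff_eq_zero p E a _ f h

theorem emb_sigma_close (a : ℤ_[p]ˣ) {c : ℚ} {n n' : ℕ} {y y' : E⸨X⸩}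
    (h : VG c (emb p E n y - emb p E n' y')) :
    VG c (emb p E n (sigma p E a y) - emb p E n' (sigma p E a y')) := by
  obtain ⟨N, j, j', e, e', rfl, h2⟩ := emb_common p n n' y y'
  have h3 : emb p E n (sigma p E a y) = emb p E (n + j) (sigma p E a ((phi p E)^[j] y)) := by
    rw [sigma_phi_iterate, emb_phi_iterate]
  have h4 : emb p E n' (sigma p E a y') = emb p E (n + j) (sigma p E a ((phi p E)^[j'] y')) := by
    rw [sigma_phi_iterate, h2, emb_phi_iterate]
  rw [e, e', ← map_sub] at h
  rw [h3, h4, ← map_sub, ← map_sub]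
  exact VG_emb_sigma p E a h

/-- `h` is the limit of `a · yᵢ`, where the `yᵢ` in `𝐄_∞` converge to `f`. Here `a` acts on
`𝐄_n = E((X^{1/p^n}))` through `X^{1/p^n} ↦ (1 + X^{1/p^n})^a - 1`. -/
def IsExt (a : ℤ_[p]ˣ) (f h : HahnSeries ℚ E) : Prop :=
  ∀ c : ℚ, ∃ (n : ℕ) (y : E⸨X⸩), VG c (f - emb p E n y) ∧ VG c (h - emb p E n (sigma p E a y))

theorem IsExt.unique {a : ℤ_[p]ˣ} {f h h' : HahnSeries ℚ E} (H : IsExt p E a f h)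
    (H' : IsExt p E a f h') : h = h' := by
  rw [← sub_eq_zero]
  apply eq_zero_of_VG
  intro c
  obtain ⟨n, y, hy, hz⟩ := H c
  obtain ⟨n', y', hy', hz'⟩ := H' c
  have h1 : VG c (emb p E n y - emb p E n' y') := by
    have := hy'.sub hy
    simpa using this
  have h2 := (hz.sub hz').add (emb_sigma_close p E a h1)
  have h3 : h - h' = h - emb p E n (sigma p E a y) - (h' - emb p E n' (sigma p E a y'))
      + (emb p E n (sigma p E a y) - emb p E n' (sigma p E a y')) := by abel
  rw [h3]
  exact h2

theorem isExt_emb (a : ℤ_[p]ˣ) (n : ℕ) (y : E⸨X⸩) :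
    IsExt p E a (emb p E n y) (emb p E n (sigma p E a y)) := fun c =>
  ⟨n, y, by simp [VG_zero], by simp [VG_zero]⟩

theorem IsExt.add {a : ℤ_[p]ˣ} {f h f' h' : HahnSeries ℚ E} (H : IsExt p E a f h)
    (H' : IsExt p E a f' h') : IsExt p E a (f + f') (h + h') := by
  intro c
  obtain ⟨n, y, hy, hz⟩ := H c
  obtain ⟨n', y', hy', hz'⟩ := H' c
  refine ⟨n + n', (phi p E)^[n'] y + (phi p E)^[n] y', ?_, ?_⟩
  · rw [map_add, emb_phi_iterate, add_comm n, emb_phi_iterate, add_sub_add_comm]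
    exact hy.add hy'
  · rw [map_add, map_add, sigma_phi_iterate, sigma_phi_iterate, emb_phi_iterate, add_comm n,
      emb_phi_iterate, add_sub_add_comm]
    exact hz.add hz'

theorem IsExt.mul {a : ℤ_[p]ˣ} {f h f' h' : HahnSeries ℚ E} (H : IsExt p E a f h)
    (H' : IsExt p E a f' h') : IsExt p E a (f * f') (h * h') := by
  intro c
  obtain ⟨A, hA0, hA⟩ := exists_VG f
  obtain ⟨A', hA0', hA'⟩ := exists_VG f'
  obtain ⟨B, hB0, hB⟩ := exists_VG h
  obtain ⟨B', hB0', hB'⟩ := exists_VG h'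
  obtain ⟨n, y, hy, hz⟩ := H (max c 0 - A - A' - B - B')
  obtain ⟨n', y', hy', hz'⟩ := H' (max c 0 - A - A' - B - B')
  refine ⟨n + n', (phi p E)^[n'] y * (phi p E)^[n] y', ?_, ?_⟩
  · rw [map_mul, emb_phi_iterate, add_comm n, emb_phi_iterate]
    exact VG.mul_sub_mul hA hA' hA0 hA0' (hy.mono (by linarith)) (hy'.mono (by linarith))
  · rw [map_mul, map_mul, sigma_phi_iterate, sigma_phi_iterate, emb_phi_iterate, add_comm n,
      emb_phi_iterate]
    exact VG.mul_sub_mul hB hB' hB0 hB0' (hz.mono (by linarith)) (hz'.mono (by linarith))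

theorem exists_isExt (a : ℤ_[p]ˣ) {f : HahnSeries ℚ E} (hf : f ∈ Etilde p E) :
    ∃ h, IsExt p E a f h := by
  choose n y hy using hf
  let H : ℚ → HahnSeries ℚ E := fun c => emb p E (n c) (sigma p E a (y c))
  have hH : ∀ c d, c ≤ d → VG c (H c - H d) := by
    intro c d hcd
    apply emb_sigma_close
    have := ((hy d).mono hcd).sub (hy c)
    simpa using this
  obtain ⟨h, hh⟩ := exists_limit H hH
  exact ⟨h, fun c => ⟨n c, y c, hy c, hh c⟩⟩

theorem IsExt.mem {a : ℤ_[p]ˣ} {f h : HahnSeries ℚ E} (H : IsExt p E a f h) : h ∈ Etilde p E :=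
  fun c => let ⟨n, y, _, hz⟩ := H c; ⟨n, sigma p E a y, hz⟩

/-- The action of `a ∈ ℤ_p^×` on `Ẽ`: the extension by continuity of the action on `𝐄_∞`. -/
def sigmaTilde (a : ℤ_[p]ˣ) : Etilde p E →+* Etilde p E where
  toFun f := ⟨(exists_isExt p E a f.2).choose, (exists_isExt p E a f.2).choose_spec.mem⟩
  map_one' := Subtype.ext <| IsExt.unique p E (exists_isExt p E a (1 : Etilde p E).2).choose_spec
    (by simpa using isExt_emb p E a 0 1)
  map_zero' := Subtype.ext <| IsExt.unique p E (exists_isExt p E a (0 : Etilde p E).2).choose_spec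
    (by simpa using isExt_emb p E a 0 0)
  map_mul' f g := Subtype.ext <| IsExt.unique p E (exists_isExt p E a (f * g).2).choose_spec
    (IsExt.mul p E (exists_isExt p E a f.2).choose_spec (exists_isExt p E a g.2).choose_spec)
  map_add' f g := Subtype.ext <| IsExt.unique p E (exists_isExt p E a (f + g).2).choose_spec
    (IsExt.add p E (exists_isExt p E a f.2).choose_spec (exists_isExt p E a g.2).choose_spec)

theorem sigmaTilde_isExt (a : ℤ_[p]ˣ) (f : Etilde p E) :
    IsExt p E a (f : HahnSeries ℚ E) (sigmaTilde p E a f) :=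
  (exists_isExt p E a f.2).choose_spec

theorem sigmaTilde_algebraMap (a : ℤ_[p]ˣ) (f : E⸨X⸩) :
    sigmaTilde p E a (algebraMap E⸨X⸩ (Etilde p E) f)
      = algebraMap E⸨X⸩ (Etilde p E) (sigma p E a f) :=
  Subtype.ext <| IsExt.unique p E (sigmaTilde_isExt p E a _) (isExt_emb p E a 0 f)

end Tilde

/-! ### Super-Hölder functions and vectors -/

section SuperHolderVectors

variable (p : ℕ) [Fact p.Prime]

/-- `f : ℤ_p → M` belongs to `ℋ^{lam,mu}(ℤ_p, M)`: we have
`val_M (f x - f y) ≥ p^lam * p^i + mu` whenever `val_p (x - y) ≥ i`. -/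
def IsSuperHolder {M : Type*} [AddGroup M] (val : M → EReal) (lam mu : ℝ) (f : ℤ_[p] → M) : Prop :=
  ∀ (x y : ℤ_[p]) (i : ℕ), (p : ℤ_[p]) ^ i ∣ x - y →
    (((p : ℝ) ^ lam * (p : ℝ) ^ i + mu : ℝ) : EReal) ≤ val (f x - f y)

/-- The group `Γ_k = 1 + p^k ℤ_p`, as a subgroup of `ℤ_p^×`. -/
def Gam (k : ℕ) : Subgroup ℤ_[p]ˣ where
  carrier := {u | (p : ℤ_[p]) ^ k ∣ (u : ℤ_[p]) - 1}
  one_mem' := by simp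
  mul_mem' {u v} hu hv := by
    have : ((u * v : ℤ_[p]ˣ) : ℤ_[p]) - 1 = (u : ℤ_[p]) * ((v : ℤ_[p]) - 1) + ((u : ℤ_[p]) - 1) := by
      push_cast; ring
    change (p : ℤ_[p]) ^ k ∣ _
    rw [this]
    exact dvd_add (Dvd.dvd.mul_left hv _) hu
  inv_mem' {u} hu := by
    have : ((u⁻¹ : ℤ_[p]ˣ) : ℤ_[p]) - 1 = -((u⁻¹ : ℤ_[p]ˣ) : ℤ_[p]) * ((u : ℤ_[p]) - 1) := by
      rw [mul_sub, neg_mul, Units.inv_mul]; ring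
    change (p : ℤ_[p]) ^ k ∣ _
    rw [this]
    exact Dvd.dvd.mul_left hu _

theorem isUnit_one_add (k : ℕ) (hk : 1 ≤ k) (z : ℤ_[p]) :
    IsUnit (1 + (p : ℤ_[p]) ^ k * z) := by
  have h : (p : ℤ_[p]) ^ k * z ∈ IsLocalRing.maximalIdeal ℤ_[p] := by
    rw [PadicInt.maximalIdeal_eq_span_p, Ideal.mem_span_singleton]
    exact Dvd.dvd.mul_right (dvd_pow_self _ (by omega)) _
  by_contra hu
  have h1 : 1 + (p : ℤ_[p]) ^ k * z ∈ IsLocalRing.maximalIdeal ℤ_[p] := hu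
  have h2 := Ideal.sub_mem _ h1 h
  rw [add_sub_cancel_right] at h2
  exact (IsLocalRing.maximalIdeal.isMaximal ℤ_[p]).ne_top ((Ideal.eq_top_iff_one _).2 h2)

/-- The inverse `z ↦ 1 + p^k z` of the coordinate `1 + p^k z ↦ z` on `Γ_k`. -/
def coordInv (k : ℕ) (hk : 1 ≤ k) (z : ℤ_[p]) : Gam p k :=
  ⟨(isUnit_one_add p k hk z).unit, by
    change (p : ℤ_[p]) ^ k ∣ 1 + (p : ℤ_[p]) ^ k * z - 1
    simp⟩

/-- `M^{Γ_k-sh, lam}`: the vectors whose orbit map, read in the coordinate of `Γ_k`, belongs to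
`ℋ^{lam, mu}` for some `mu`. The operator by which `g` acts on `M` is `act g`. -/
def shLevel (k : ℕ) (hk : 1 ≤ k) {M : Type*} [AddGroup M] (val : M → EReal)
    (act : Gam p k → M → M) (lam : ℝ) : Set M :=
  {m | ∃ mu : ℝ, IsSuperHolder p val lam mu fun z => act (coordInv p k hk z) m}

/-- `M^sh`: the super-Hölder vectors. -/
def sh (k : ℕ) (hk : 1 ≤ k) {M : Type*} [AddGroup M] (val : M → EReal)
    (act : Gam p k → M → M) : Set M :=
  {m | ∃ lam : ℝ, m ∈ shLevel p k hk val act lam}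

end SuperHolderVectors

/-! ### Semilinear representations of `Γ_k` and `(φ,Γ)`-modules -/

section Modules

open Classical in
/-- The `X`-adic valuation on `𝐄 = E((X))`. -/
def valE {E : Type*} [Field E] (f : E⸨X⸩) : EReal :=
  if f = 0 then ⊤ else (((HahnSeries.order f : ℤ) : ℝ) : EReal)

open Classical in
/-- The `X`-adic valuation on `Ẽ`. -/
def valEtilde (p : ℕ) [Fact p.Prime] (E : Type*) [Field E] (f : Etilde p E) : EReal :=
  if f = 0 then ⊤ else (((HahnSeries.order (f : HahnSeries ℚ E) : ℚ) : ℝ) : EReal)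

/-- The valuation on `M` attached to a basis `b`: the minimum of the valuations of the coordinates.
Its unit ball is the lattice generated by `b`. -/
def basisVal {K M ι : Type*} [Field K] [AddCommGroup M] [Module K M] (v : K → EReal)
    (b : Module.Basis ι K M) (m : M) : EReal := ⨅ i, v (b.repr m i)

variable (p : ℕ) [Fact p.Prime] (E : Type*) [Field E] [CharP E p] (k : ℕ)
  (M : Type*) [AddCommGroup M] [Module E⸨X⸩ M] [DistribMulAction (Gam p k) M]

/-- The action of `Γ_k` on `M` is semilinear with respect to its action on `𝐄`. -/
def IsSemilinear : Prop :=
  ∀ (g : Gam p k) (f : E⸨X⸩) (m : M), g • (f • m) = sigma p E g f • (g • m)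

variable {E M}

/-- A basis of `M` is good if the `E[[X]]`-lattice that it generates is stable under `Γ_k`. -/
def IsGood {ι : Type*} (b : Module.Basis ι E⸨X⸩ M) : Prop :=
  ∀ (g : Gam p k) (m : M), (∀ i, b.repr m i ∈ (HahnSeries.ofPowerSeries ℤ E).range) →
    ∀ i, b.repr (g • m) i ∈ (HahnSeries.ofPowerSeries ℤ E).range

/-- The semilinear action of `g ∈ Γ_k` on `Ẽ ⊗ M`, with `g (x ⊗ m) = g x ⊗ g m`. -/
def tensorAct (hM : IsSemilinear p E k M) (g : Gam p k) :
    Etilde p E ⊗[E⸨X⸩] M →+ Etilde p E ⊗[E⸨X⸩] M :=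
  TensorProduct.liftAddHom
    { toFun := fun x =>
        { toFun := fun m => sigmaTilde p E g x ⊗ₜ[E⸨X⸩] (g • m)
          map_zero' := by simp
          map_add' := fun m m' => by rw [smul_add, TensorProduct.tmul_add] }
      map_zero' := by ext m; simp
      map_add' := fun x x' => by
        ext m
        simp [TensorProduct.add_tmul] }
    (fun f x m => by
      change sigmaTilde p E g (f • x) ⊗ₜ[E⸨X⸩] (g • m) = sigmaTilde p E g x ⊗ₜ[E⸨X⸩] (g • (f • m))
      rw [hM, ← TensorProduct.smul_tmul (sigma p E g f), Algebra.smul_def, map_mul,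
        sigmaTilde_algebraMap, ← Algebra.smul_def])

theorem tensorAct_tmul (hM : IsSemilinear p E k M) (g : Gam p k) (x : Etilde p E) (m : M) :
    tensorAct p k hM g (x ⊗ₜ m) = sigmaTilde p E g x ⊗ₜ (g • m) := rfl

/-- `M^{Γ_k-sh, lam}`, for the valuation on `M` attached to the basis `b`. -/
def modShLevel (hk : 1 ≤ k) {ι : Type*} (b : Module.Basis ι E⸨X⸩ M) (lam : ℝ) : Set M :=
  shLevel p k hk (basisVal valE b) (fun g m => g • m) lam

/-- `M^sh`, for the valuation on `M` attached to the basis `b`. -/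
def modSh (hk : 1 ≤ k) {ι : Type*} (b : Module.Basis ι E⸨X⸩ M) : Set M :=
  sh p k hk (basisVal valE b) (fun g m => g • m)

/-- `(Ẽ ⊗ M)^{Γ_k-sh, lam}`, for the valuation on `Ẽ ⊗ M` attached to the basis `b` of `M`. -/
def tensorShLevel (hk : 1 ≤ k) (hM : IsSemilinear p E k M) {ι : Type*}
    (b : Module.Basis ι E⸨X⸩ M) (lam : ℝ) : Set (Etilde p E ⊗[E⸨X⸩] M) :=
  shLevel p k hk (basisVal (valEtilde p E) (b.baseChange (Etilde p E)))
    (fun g x => tensorAct p k hM g x) lam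

/-- `(Ẽ ⊗ M)^sh`, for the valuation on `Ẽ ⊗ M` attached to the basis `b` of `M`. -/
def tensorSh (hk : 1 ≤ k) (hM : IsSemilinear p E k M) {ι : Type*}
    (b : Module.Basis ι E⸨X⸩ M) : Set (Etilde p E ⊗[E⸨X⸩] M) :=
  sh p k hk (basisVal (valEtilde p E) (b.baseChange (Etilde p E)))
    (fun g x => tensorAct p k hM g x)

variable (M) in
/-- The subspace `V ⊗ M` of `Ẽ ⊗ M`, for an `𝐄`-subspace `V` of `Ẽ`. -/
def subTensor (V : Submodule E⸨X⸩ (Etilde p E)) : Submodule E⸨X⸩ (Etilde p E ⊗[E⸨X⸩] M) :=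
  LinearMap.range (LinearMap.rTensor M V.subtype)

/-- `phiM` makes the `𝐄`-vector space `M` with its semilinear action of `Γ_k` into a
`(φ,Γ)`-module: it is `φ`-semilinear, commutes with `Γ_k`, and its matrix is invertible. -/
structure IsPhiGamma (phiM : M →+ M) : Prop where
  semilinear : ∀ (f : E⸨X⸩) (m : M), phiM (f • m) = phi p E f • phiM m
  commutes : ∀ (g : Gam p k) (m : M), phiM (g • m) = g • phiM m
  invertible : ∀ b : Module.Basis (Fin (Module.finrank E⸨X⸩ M)) E⸨X⸩ M,
    IsUnit (b.toMatrix fun j => phiM (b j))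

end Modules

end SuperHolder

end

/-!
Write `w = 1 + X`. Every element of `Ẽ` has a unique expansion `∑ w^(-i) aᵢ`, with `i` running over
`ℤ[1/p] ∩ [0, 1)` and `aᵢ ∈ E((X))` tending to `0`, and it belongs to `𝐄_m` exactly when only the `i`
with denominator dividing `p^m` occur. The component `aᵢ` of `f` is `tate (w^i f)`, where
`tate : Ẽ → E((X))` extends by continuity the iterates of the left inverse `ψ` of `φ`
(`eq_sum_phi_psi_iterate`, `mem_Elevel_of_tate_eq_zero`). The map `tate` is `E((X))`-linear, lowers
valuations by a bounded amount, and commutes with the elements `1 + p^s` of `ℤ_p^×`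
(`tate_sigmaTilde`). The same holds for its extension `tateM` to `Ẽ ⊗ M`.

Let `M = M^{Γ_k-sh, k - m₀}`, let `m ≥ m₀` and let `x` be a super-Hölder vector of `Ẽ ⊗ M` of level
`k - m`. Take `i = j/p^r` with `j` prime to `p` and `r > m`, and let `y ∈ M` be the component of `x`
along `w^(-i)`. For large `s`, the element `γ = 1 + p^s` multiplies `w^i` by `a = w^(j p^(s-r))`, so
that `(a - 1) y = (γ y - y) - a z`, where `z` is the component of `γ x - x`
(`sub_one_smul_tateM`). Both `γ y - y` and `z` have valuation at least `p^(s-m)`, up to a constant,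
whereas `a - 1` has valuation exactly `p^(s-r)`. Letting `s` tend to infinity gives `y = 0`
(`tateM_eq_zero`), so `x ∈ 𝐄_m ⊗ M`. The converse inclusion is a product rule for orbit maps
(`subTensor_subset`), based on the fact that `E((X))` itself is super-Hölder of level `k`
(`LGE.sigma_sub_sigma`).

For a `(φ,Γ)`-module one can take `m₀ = 0`. Indeed, let `G` be the matrix of `γ ∈ 1 + p^s ℤ_p` and
`P` that of `φ`. Then `G = P φ(G) γ(P)⁻¹`, so that a lower bound `c` for the valuation of `G - 1`
improves to `min (p c - A) (p^s - A)` with a constant `A`. If `γ` is close enough to `1` for `c` to be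
larger than `A`, which continuity ensures, iterating gives the bound `p^s - A`
(`exists_MGE_smul_sub_of_phi`).

Finally, a good basis exists because the orbits of the compact group `Γ_k` are bounded, so that the
`E[[X]]`-module generated by the orbits of the vectors of a basis is a finitely generated torsion-free
module over a principal ideal domain (`exists_isGood`).
-/

noncomputable section

namespace SuperHolder

/-! ### Lower bounds for valuations -/

section ValGE

variable {Γ E : Type*} [AddCommGroup Γ] [LinearOrder Γ] [Field E]

/-- `ValGE ν r f` says that the valuation of the Hahn series `f` is at least the real number `r`,
where exponents are compared with real numbers through the additive map `ν`. -/
def ValGE (ν : Γ →+ ℝ) (r : ℝ) (f : HahnSeries Γ E) : Prop := ∀ q, ν q < r → f.coeff q = 0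

namespace ValGE

variable {ν : Γ →+ ℝ} {r s : ℝ} {f g : HahnSeries Γ E}

theorem zero (r : ℝ) : ValGE ν r (0 : HahnSeries Γ E) := fun _ _ => rfl

theorem mono (h : ValGE ν s f) (hrs : r ≤ s) : ValGE ν r f := fun q hq => h q (hq.trans_le hrs)

theorem add (hf : ValGE ν r f) (hg : ValGE ν r g) : ValGE ν r (f + g) := fun q hq => by
  simp [hf q hq, hg q hq]

theorem neg (hf : ValGE ν r f) : ValGE ν r (-f) := fun q hq => by simp [hf q hq]

theorem sub (hf : ValGE ν r f) (hg : ValGE ν r g) : ValGE ν r (f - g) := fun q hq => by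
  simp [hf q hq, hg q hq]

theorem sum {ι : Type*} {t : Finset ι} {F : ι → HahnSeries Γ E} (h : ∀ i ∈ t, ValGE ν r (F i)) :
    ValGE ν r (∑ i ∈ t, F i) :=
  Finset.sum_induction _ _ (fun _ _ => add) (zero r) h

theorem mul [IsOrderedAddMonoid Γ] (hf : ValGE ν r f) (hg : ValGE ν s g) : ValGE ν (r + s) (f * g) := by
  intro q hq
  rw [HahnSeries.coeff_mul]
  refine Finset.sum_eq_zero fun ij hij => ?_
  rw [Finset.mem_antidiagonal] at hij
  have h : ν ij.1 + ν ij.2 < r + s := by rwa [← map_add, hij.2.2]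
  by_cases h1 : ν ij.1 < r
  · rw [hf _ h1, zero_mul]
  · rw [hg _ (by linarith), mul_zero]

theorem one : ValGE ν 0 (1 : HahnSeries Γ E) := by
  intro q hq
  rw [HahnSeries.coeff_one, if_neg]
  rintro rfl
  simp at hq

theorem pow [IsOrderedAddMonoid Γ] (hf : ValGE ν r f) (n : ℕ) : ValGE ν (n * r) (f ^ n) := by
  induction n with
  | zero => simpa using one
  | succ n ih =>
    rw [pow_succ]
    exact (ih.mul hf).mono (by push_cast; linarith)

end ValGE

/-- The valuation of a Laurent series is at least `r`. -/
abbrev LGE (r : ℝ) (f : E⸨X⸩) : Prop := ValGE (Int.castAddHom ℝ) r f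

/-- The valuation of a Hahn series with rational exponents is at least `r`. -/
abbrev HGE (r : ℝ) (f : HahnSeries ℚ E) : Prop := ValGE (Rat.castHom ℝ : ℚ →+ ℝ) r f

theorem LGE_iff {r : ℝ} {f : E⸨X⸩} : LGE r f ↔ ∀ j : ℤ, (j : ℝ) < r → f.coeff j = 0 := Iff.rfl

theorem HGE_iff {r : ℝ} {f : HahnSeries ℚ E} :
    HGE r f ↔ ∀ q : ℚ, (q : ℝ) < r → f.coeff q = 0 := Iff.rfl

theorem LGE_iff_ceil {r : ℝ} {f : E⸨X⸩} : LGE r f ↔ ∀ j < ⌈r⌉, f.coeff j = 0 := by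
  simp_rw [LGE_iff, Int.lt_ceil]

theorem LGE_intCast {d : ℤ} {f : E⸨X⸩} : LGE (d : ℝ) f ↔ ∀ j < d, f.coeff j = 0 := by
  simp_rw [LGE_iff, Int.cast_lt]

theorem HGE_iff_VG {c : ℚ} {f : HahnSeries ℚ E} : HGE (c : ℝ) f ↔ VG c f := by
  simp_rw [HGE_iff, VG_iff, Rat.cast_lt]

theorem LGE_order (f : E⸨X⸩) : LGE (f.order : ℝ) f :=
  LGE_intCast.2 fun _ hj => HahnSeries.coeff_eq_zero_of_lt_order hj

theorem exists_HGE (f : HahnSeries ℚ E) : ∃ r : ℝ, HGE r f := by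
  obtain ⟨c, -, hc⟩ := exists_VG f
  exact ⟨c, HGE_iff_VG.2 hc⟩

theorem le_valE_iff {r : ℝ} {f : E⸨X⸩} : (r : EReal) ≤ valE f ↔ LGE r f := by
  classical
  rw [valE]
  split_ifs with h
  · simp [h, ValGE.zero]
  · rw [EReal.coe_le_coe_iff]
    refine ⟨fun hr => (LGE_order f).mono hr, fun hr => ?_⟩
    by_contra! hlt
    exact HahnSeries.coeff_order_eq_zero.not.2 h (hr _ hlt)

theorem le_valEtilde_iff {p : ℕ} [Fact p.Prime] {r : ℝ} {f : Etilde p E} :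
    (r : EReal) ≤ valEtilde p E f ↔ HGE r (f : HahnSeries ℚ E) := by
  classical
  rw [valEtilde]
  split_ifs with h
  · simp [h, ValGE.zero]
  · have h' : (f : HahnSeries ℚ E) ≠ 0 := fun h0 => h (Subtype.ext h0)
    rw [EReal.coe_le_coe_iff, HGE_iff]
    refine ⟨fun hr q hq => HahnSeries.coeff_eq_zero_of_lt_order ?_, fun hr => ?_⟩
    · exact_mod_cast hq.trans_le hr
    · by_contra! hlt
      exact HahnSeries.coeff_order_eq_zero.not.2 h' (hr _ hlt)

theorem LGE.inv {f : E⸨X⸩} {d : ℤ} (h : f.coeff d ≠ 0) : LGE (-(d : ℝ)) f⁻¹ := by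
  have hf : f ≠ 0 := by rintro rfl; simp at h
  have h1 : f.order + f⁻¹.order = 0 := by
    rw [← HahnSeries.order_mul hf (inv_ne_zero hf), mul_inv_cancel₀ hf, HahnSeries.order_one]
  have h2 : f.order ≤ d := HahnSeries.order_le_of_coeff_ne_zero h
  refine (LGE_order f⁻¹).mono ?_
  have : -d ≤ f⁻¹.order := by omega
  exact_mod_cast this

/-- A Laurent series whose valuation exceeds every bound is zero. -/
theorem eq_zero_of_LGE {f : E⸨X⸩} (h : ∀ r, LGE r f) : f = 0 := by
  ext j
  exact h (j + 1) j (by simp)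

theorem LGE_coe {N : ℕ} {f : PowerSeries E} (h : PowerSeries.X ^ N ∣ f) :
    LGE (N : ℝ) (HahnSeries.ofPowerSeries ℤ E f) := by
  rw [PowerSeries.X_pow_dvd_iff] at h
  have := (LGE_intCast (d := N) (f := HahnSeries.ofPowerSeries ℤ E f)).2 fun j hj => by
    rw [PowerSeries.coeff_coe]
    split_ifs with h0
    · rfl
    · exact h _ (by omega)
  exact_mod_cast this

theorem LGE_zero_iff {f : E⸨X⸩} : LGE 0 f ↔ f ∈ (HahnSeries.ofPowerSeries ℤ E).range := by
  constructor
  · intro h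
    refine ⟨PowerSeries.mk fun n => f.coeff n, ?_⟩
    ext j
    rw [PowerSeries.coeff_coe]
    split_ifs with hj
    · exact (h j (by simpa using hj)).symm
    · rw [PowerSeries.coeff_mk, Int.natAbs_of_nonneg (not_lt.1 hj)]
  · rintro ⟨g, rfl⟩
    simpa using LGE_coe (N := 0) (f := g) (by simp)

theorem LGE_single (d : ℤ) (e : E) : LGE (d : ℝ) (HahnSeries.single d e) :=
  LGE_intCast.2 fun _ hj => HahnSeries.coeff_single_of_ne hj.ne

/-- Every Laurent series of valuation at least `d` is `X^d` times a power series. -/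
theorem exists_eq_single_mul (f : E⸨X⸩) {d : ℤ} (h : LGE (d : ℝ) f) : ∃ g : PowerSeries E,
    f = HahnSeries.single d 1 * HahnSeries.ofPowerSeries ℤ E g := by
  have h1 : LGE 0 (HahnSeries.single (-d) 1 * f) :=
    ((LGE_single (-d) 1).mul h).mono (by simp)
  obtain ⟨g, hg⟩ := LGE_zero_iff.1 h1
  refine ⟨g, ?_⟩
  rw [hg, ← mul_assoc, HahnSeries.single_mul_single]
  simp

variable (p : ℕ) [Fact p.Prime]

theorem HGE_emb {r : ℝ} {n : ℕ} {f : E⸨X⸩} :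
    HGE r (emb p E n f) ↔ LGE (r * (p : ℝ) ^ n) f := by
  have h0 : (0 : ℝ) < (p : ℝ) ^ n := pow_pos (by exact_mod_cast (Fact.out : p.Prime).pos) _
  constructor
  · intro h j hj
    rw [← emb_coeff_div p E n f j]
    apply h
    have : ((((p : ℚ) ^ n)⁻¹ * j : ℚ) : ℝ) < r := by
      push_cast
      rwa [inv_mul_lt_iff₀ h0, mul_comm]
    exact this
  · intro h q hq
    by_cases hj : ∃ m : ℤ, ((p : ℚ) ^ n)⁻¹ * m = q
    · obtain ⟨j, rfl⟩ := hj
      rw [emb_coeff_div]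
      apply h
      have hq' : ((((p : ℚ) ^ n)⁻¹ * j : ℚ) : ℝ) < r := hq
      push_cast at hq'
      rwa [inv_mul_lt_iff₀ h0, mul_comm] at hq'
    · exact emb_coeff_of_forall_ne p E n f fun m hm => hj ⟨m, hm⟩

theorem LGE.phi {r : ℝ} {f : E⸨X⸩} (h : LGE r f) : LGE (p * r) (phi p E f) := by
  have h0 : (0 : ℝ) < p := by exact_mod_cast (Fact.out : p.Prime).pos
  have h1 : HGE r (emb p E 0 f) := (HGE_emb p).2 (by simpa using h)
  rw [← emb_phi, HGE_emb] at h1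
  exact h1.mono (by simp [mul_comm])

end ValGE

/-! ### The action of `ℤ_p^×` on `E((X))` -/

section Sigma

variable (p : ℕ) [Fact p.Prime] (E : Type*) [Field E]

/-- The element `1 + X` of `E((X))`. -/
def onePlus : E⸨X⸩ := HahnSeries.ofPowerSeries ℤ E (1 + PowerSeries.X)

theorem phi_onePlus [CharP E p] : phi p E (onePlus E) = onePlus E ^ p := by
  have : ExpChar E p := ExpChar.prime Fact.out
  have : CharP (PowerSeries E) p := charP_of_injective_ringHom
    (f := (PowerSeries.C : E →+* PowerSeries E)) PowerSeries.C_injective p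
  have : ExpChar (PowerSeries E) p := ExpChar.prime Fact.out
  rw [onePlus, phi_coe, ← map_pow, add_pow_expChar]
  simp

theorem onePlus_coeff (n : ℤ) : (onePlus E).coeff n = if n = 0 ∨ n = 1 then 1 else 0 := by
  rw [onePlus, PowerSeries.coeff_coe]
  by_cases hn : n < 0
  · rw [if_pos hn, if_neg (by omega)]
  · lift n to ℕ using not_lt.1 hn
    rw [if_neg hn, Int.natAbs_natCast, map_add, PowerSeries.coeff_one, PowerSeries.coeff_X]
    rcases n with _ | _ | n
    · simp
    · simp
    · simp
      omega

theorem onePlus_ne_zero : onePlus E ≠ 0 := fun h => by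
  have := onePlus_coeff E 0
  simp [h] at this

variable {E} in
/-- Powers of `1 + X`, with positive or negative exponents, are integral. -/
theorem LGE_onePlus_pow (j : ℕ) : LGE 0 (onePlus E ^ j) ∧ LGE 0 (onePlus E ^ j)⁻¹ := by
  have h1 : LGE 0 (onePlus E) := LGE_zero_iff.2 ⟨_, rfl⟩
  have h2 : LGE 0 (onePlus E)⁻¹ := by
    simpa using LGE.inv (f := onePlus E) (d := 0) (by simp [onePlus_coeff])
  constructor
  · simpa using h1.pow j
  · rw [← inv_pow]
    simpa using h2.pow j

variable [CharP E p]

theorem onePlusXPow_add (a b : ℤ_[p]) :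
    onePlusXPow p E (a + b) = onePlusXPow p E a * onePlusXPow p E b := by
  ext n
  simp only [onePlusXPow, PowerSeries.coeff_mk, PowerSeries.coeff_mul,
    Ring.add_choose_eq n (Commute.all a b), map_sum, map_mul]

theorem onePlusXPow_zero : onePlusXPow p E 0 = 1 := by
  ext n
  simp only [onePlusXPow, PowerSeries.coeff_mk, PowerSeries.coeff_one]
  rcases n with _ | n <;> simp

theorem onePlusXPow_one : onePlusXPow p E 1 = 1 + PowerSeries.X := by
  ext n
  have h : Ring.choose (1 : ℤ_[p]) n = (Nat.choose 1 n : ℕ) := by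
    rw [← Ring.choose_natCast, Nat.cast_one]
  simp only [onePlusXPow, PowerSeries.coeff_mk, map_add, PowerSeries.coeff_one,
    PowerSeries.coeff_X, h, map_natCast]
  rcases n with _ | _ | n
  · simp
  · simp
  · simp [Nat.choose_eq_zero_of_lt (show 1 < n + 1 + 1 by omega)]

theorem onePlusXPow_natCast_mul (n : ℕ) (z : ℤ_[p]) :
    onePlusXPow p E (n * z) = onePlusXPow p E z ^ n := by
  induction n with
  | zero => simp [onePlusXPow_zero]
  | succ n ih => rw [Nat.cast_succ, add_mul, one_mul, onePlusXPow_add, ih, pow_succ]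

/-- `X^(p^s)` divides `(1+X)^a - (1+X)^b` when `a - b ∈ p^s ℤ_p`. -/
theorem X_pow_dvd_gam_sub {s : ℕ} {a b : ℤ_[p]} (h : (p : ℤ_[p]) ^ s ∣ a - b) :
    (PowerSeries.X : PowerSeries E) ^ p ^ s ∣ gam p E a - gam p E b := by
  have : CharP (PowerSeries E) p := charP_of_injective_ringHom
    (f := (PowerSeries.C : E →+* PowerSeries E)) PowerSeries.C_injective p
  have : ExpChar (PowerSeries E) p := ExpChar.prime Fact.out
  obtain ⟨z, hz⟩ := h
  have ha : a = b + ((p ^ s : ℕ) : ℤ_[p]) * z := by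
    push_cast
    rw [← hz]
    ring
  have : gam p E a - gam p E b = onePlusXPow p E b * gam p E z ^ p ^ s := by
    rw [gam, gam, gam, ha, onePlusXPow_add, onePlusXPow_natCast_mul, sub_pow_expChar_pow, one_pow]
    ring
  rw [this]
  exact Dvd.dvd.mul_left (pow_dvd_pow_of_dvd (PowerSeries.X_dvd_iff.2 (gam_constCoeff p E z)) _) _

omit [CharP E p] in
variable {E} in
/-- Substituting two congruent power series gives congruent results. -/
theorem X_pow_dvd_subst_sub {N : ℕ} {u v : PowerSeries E} (hu : u.constantCoeff = 0)
    (hv : v.constantCoeff = 0) (h : PowerSeries.X ^ N ∣ u - v) (f : PowerSeries E) :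
    PowerSeries.X ^ N ∣ f.subst u - f.subst v := by
  -- compare the substitution in `f` with the one in a truncation of `f`
  have key : ∀ {u : PowerSeries E} (hu : u.constantCoeff = 0),
      PowerSeries.X ^ N ∣ f.subst u - Polynomial.aeval u (f.trunc N) := by
    intro u hu
    have hu' := PowerSeries.HasSubst.of_constantCoeff_zero' hu
    obtain ⟨g, hg⟩ : (PowerSeries.X : PowerSeries E) ^ N ∣ f - (f.trunc N : PowerSeries E) := by
      rw [PowerSeries.X_pow_dvd_iff]
      intro m hm
      rw [map_sub, Polynomial.coeff_coe, PowerSeries.coeff_trunc, if_pos hm, sub_self]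
    rw [← PowerSeries.subst_coe hu', ← PowerSeries.coe_substAlgHom hu', ← map_sub, hg, map_mul,
      map_pow, PowerSeries.substAlgHom_X]
    exact Dvd.dvd.mul_right (pow_dvd_pow_of_dvd (PowerSeries.X_dvd_iff.2 hu) _) _
  have h3 : PowerSeries.X ^ N ∣ Polynomial.aeval u (f.trunc N) - Polynomial.aeval v (f.trunc N) := by
    refine h.trans ?_
    rw [← Polynomial.eval_map_algebraMap, ← Polynomial.eval_map_algebraMap]
    exact Polynomial.sub_dvd_eval_sub _ _ _
  have h4 := dvd_sub (dvd_add (key hu) h3) (key hv)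
  convert h4 using 1
  ring

theorem sigma_one (f : E⸨X⸩) : sigma p E 1 f = f := by
  suffices h : sigma p E 1 = RingHom.id _ from DFunLike.congr_fun h f
  refine IsLocalization.ringHom_ext (Submonoid.powers (PowerSeries.X : PowerSeries E)) ?_
  ext1 g
  change sigma p E 1 (HahnSeries.ofPowerSeries ℤ E g) = HahnSeries.ofPowerSeries ℤ E g
  rw [sigma_coe, Units.val_one, gam, onePlusXPow_one, add_sub_cancel_left]
  congr 1
  rw [← PowerSeries.map_algebraMap_eq_subst_X]
  simp

variable {E}

theorem sigma_onePlus (a : ℤ_[p]ˣ) :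
    sigma p E a (onePlus E) = HahnSeries.ofPowerSeries ℤ E (onePlusXPow p E a) := by
  have hs := gam_hasSubst p E (a : ℤ_[p])
  rw [onePlus, sigma_coe, ← PowerSeries.coe_substAlgHom hs, map_add, map_one,
    PowerSeries.substAlgHom_X, gam, add_sub_cancel]

theorem sigma_onePlus_of_eq {a : ℤ_[p]ˣ} {s : ℕ} (ha : (a : ℤ_[p]) = 1 + (p : ℤ_[p]) ^ s) :
    sigma p E a (onePlus E) = onePlus E * onePlus E ^ p ^ s := by
  have h : (1 : ℤ_[p]) + (p : ℤ_[p]) ^ s = 1 + ((p ^ s : ℕ) : ℤ_[p]) * 1 := by push_cast; ring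
  rw [sigma_onePlus, ha, h, onePlusXPow_add, onePlusXPow_natCast_mul, onePlusXPow_one, map_mul,
    map_pow, onePlus]

theorem LGE.sigma (a : ℤ_[p]ˣ) {r : ℝ} {f : E⸨X⸩} (h : LGE r f) : LGE r (sigma p E a f) := by
  rw [LGE_iff_ceil] at *
  exact sigma_coeff_eq_zero p E a _ f h

omit [CharP E p] in
theorem dvd_zpow_sub_zpow {R : Type*} [CommRing R] {x : R} {u v : Rˣ} (h : x ∣ (u : R) - v)
    (d : ℤ) : x ∣ ((u ^ d : Rˣ) : R) - ((v ^ d : Rˣ) : R) := by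
  let π : R →+* R ⧸ Ideal.span {x} := Ideal.Quotient.mk _
  have h1 : Units.map π.toMonoidHom u = Units.map π.toMonoidHom v := by
    ext
    exact Ideal.Quotient.eq.2 (Ideal.mem_span_singleton.2 h)
  have h2 : Units.map π.toMonoidHom (u ^ d) = Units.map π.toMonoidHom (v ^ d) := by
    rw [map_zpow, map_zpow, h1]
  exact Ideal.mem_span_singleton.1 (Ideal.Quotient.eq.1 (congrArg Units.val h2))

/-- The series `(1+X)^a - 1` is `X` times a unit. -/
theorem exists_unit_gam (a : ℤ_[p]ˣ) :
    ∃ u : (PowerSeries E)ˣ, gam p E (a : ℤ_[p]) = PowerSeries.X * (u : PowerSeries E) := by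
  obtain ⟨w, hw⟩ : ∃ w : PowerSeries E, gam p E (a : ℤ_[p]) = PowerSeries.X * w :=
    PowerSeries.X_dvd_iff.2 (gam_constCoeff p E a)
  have hwu : IsUnit w := by
    rw [PowerSeries.isUnit_iff_constantCoeff, isUnit_iff_ne_zero]
    have := gam_coeff_one p E a
    rw [hw, show (1 : ℕ) = 0 + 1 from rfl, PowerSeries.coeff_succ_X_mul] at this
    simpa using this
  obtain ⟨u, rfl⟩ := hwu
  exact ⟨u, hw⟩

theorem sigma_single_mul {a : ℤ_[p]ˣ} {u : (PowerSeries E)ˣ}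
    (hu : gam p E (a : ℤ_[p]) = PowerSeries.X * (u : PowerSeries E)) (d : ℤ) (g : PowerSeries E) :
    sigma p E a (HahnSeries.single d 1 * HahnSeries.ofPowerSeries ℤ E g)
      = HahnSeries.single d 1 * HahnSeries.ofPowerSeries ℤ E
        (((u ^ d : (PowerSeries E)ˣ) : PowerSeries E) * g.subst (gam p E (a : ℤ_[p]))) := by
  have hsd : HahnSeries.single d (1 : E) = (HahnSeries.single (1 : ℤ) (1 : E)) ^ d :=
    RatFunc.single_zpow d
  have hX : sigma p E a (HahnSeries.single (1 : ℤ) (1 : E)) =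
      HahnSeries.single (1 : ℤ) (1 : E) * HahnSeries.ofPowerSeries ℤ E u := by
    rw [← HahnSeries.ofPowerSeries_X, sigma_coe, PowerSeries.subst_X (gam_hasSubst p E _), hu,
      map_mul]
  have hud : (HahnSeries.ofPowerSeries ℤ E u) ^ d
      = HahnSeries.ofPowerSeries ℤ E ((u ^ d : (PowerSeries E)ˣ) : PowerSeries E) := by
    have := map_zpow (Units.map (HahnSeries.ofPowerSeries ℤ E : _ →* E⸨X⸩)) u d
    have h2 := congrArg (fun x : (E⸨X⸩)ˣ => (x : E⸨X⸩)) this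
    rw [Units.val_zpow_eq_zpow_val] at h2
    exact h2.symm
  rw [hsd, map_mul, map_zpow₀, hX, mul_zpow, sigma_coe, hud, map_mul, mul_assoc]

/-- The orbit maps of `ℤ_p^×` on `E((X))` are super-Hölder: if `a` and `b` are congruent modulo
`p^s`, they act in the same way up to an error that raises the valuation by `p^s - 1`. -/
theorem LGE.sigma_sub_sigma {a b : ℤ_[p]ˣ} {s : ℕ} (hab : (p : ℤ_[p]) ^ s ∣ (a : ℤ_[p]) - b)
    {r : ℝ} {f : E⸨X⸩} (h : LGE r f) :
    LGE (r + (p ^ s - 1)) (SuperHolder.sigma p E a f - SuperHolder.sigma p E b f) := by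
  obtain ⟨g, rfl⟩ := exists_eq_single_mul f (d := ⌈r⌉) (LGE_intCast.2 (LGE_iff_ceil.1 h))
  obtain ⟨u, hu⟩ := exists_unit_gam (E := E) p a
  obtain ⟨v, hv⟩ := exists_unit_gam (E := E) p b
  obtain ⟨N, hN⟩ : ∃ N, p ^ s = N + 1 :=
    ⟨p ^ s - 1, (Nat.sub_add_cancel (Nat.one_le_pow _ _ (Fact.out : p.Prime).pos)).symm⟩
  have h1 := X_pow_dvd_gam_sub p E hab
  have h2 : (PowerSeries.X : PowerSeries E) ^ N ∣ (u : PowerSeries E) - v := by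
    rw [hu, hv, ← mul_sub, hN, pow_succ'] at h1
    exact (mul_dvd_mul_iff_left PowerSeries.X_ne_zero).1 h1
  have h3 := X_pow_dvd_subst_sub (gam_constCoeff p E _) (gam_constCoeff p E _)
    ((pow_dvd_pow _ (by omega : N ≤ p ^ s)).trans h1) g
  rw [sigma_single_mul p hu, sigma_single_mul p hv, ← mul_sub, ← map_sub]
  have hNr : ((p : ℝ) ^ s - 1) = N := by
    have : ((p ^ s : ℕ) : ℝ) = ((N + 1 : ℕ) : ℝ) := by rw [hN]
    push_cast at this
    linarith
  rw [hNr]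
  -- `a` sends `X^d g` to `X^d u^d g(σ X)`, and both `u^d` and `g(σ X)` change by a multiple of `X^N`
  refine ((LGE_single ⌈r⌉ 1).mul (LGE_coe (N := N) ?_)).mono (by linarith [Int.le_ceil r])
  have h4 := dvd_add (Dvd.dvd.mul_left h3 ((u ^ ⌈r⌉ : (PowerSeries E)ˣ) : PowerSeries E))
    (Dvd.dvd.mul_right (dvd_zpow_sub_zpow h2 ⌈r⌉) (g.subst (gam p E (b : ℤ_[p]))))
  convert h4 using 1
  ring

end Sigma

/-! ### The left inverse `ψ` of Frobenius -/

section Psi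

variable (p : ℕ) [Fact p.Prime] (E : Type*) [Field E]

/-- The `j`-th section of a Laurent series: `∑ aₙ Xⁿ ↦ ∑ a_{pn+j} Xⁿ`. -/
def sect (j : ℕ) : E⸨X⸩ →+ E⸨X⸩ where
  toFun f := HahnSeries.ofSuppBddBelow (fun n : ℤ => f.coeff (p * n + j)) (by
    have hp : (0 : ℤ) < p := by exact_mod_cast (Fact.out : p.Prime).pos
    refine ⟨-(|f.order| + j), fun n hn => ?_⟩
    by_contra! hlt
    refine hn (HahnSeries.coeff_eq_zero_of_lt_order ?_)
    have h1 := neg_abs_le f.order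
    have h2 := abs_nonneg f.order
    nlinarith)
  map_zero' := by ext; simp
  map_add' f g := by ext; rfl

variable {E}

theorem sect_coeff (j : ℕ) (f : E⸨X⸩) (n : ℤ) : (sect p E j f).coeff n = f.coeff (p * n + j) := rfl

variable (E) in
/-- The map `ψ` on `E((X))`, the left inverse of `φ` that kills `(1+X)^j φ(E((X)))` for `0 < j < p`.
Since `X^j = ((1+X) - 1)^j`, it sends `X^j φ(g)` to `(-1)^j g` for `0 ≤ j < p`. -/
def psi : E⸨X⸩ →+ E⸨X⸩ := ∑ j ∈ Finset.range p, ((-1 : ℤ) ^ j) • sect p E j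

theorem psi_apply (f : E⸨X⸩) : psi p E f = ∑ j ∈ Finset.range p, ((-1 : ℤ) ^ j) • sect p E j f := by
  simp [psi]

theorem single_mul_phi_coeff (l : ℤ) (g : E⸨X⸩) (n : ℤ) :
    (HahnSeries.single l (1 : E) * phi p E g).coeff n = (phi p E g).coeff (n - l) := by
  rw [show n = (n - l) + l by ring, HahnSeries.coeff_single_mul_add, one_mul]
  simp

omit [Fact p.Prime] in
theorem not_dvd_of_ne {j l : ℕ} (hj : j < p) (hl : l < p) (h : j ≠ l) (n : ℤ) :
    ¬ (p : ℤ) ∣ p * n + j - l := by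
  intro hd
  have h1 : (p : ℤ) ∣ (j : ℤ) - l := by
    have := dvd_sub hd (dvd_mul_right (p : ℤ) n)
    rwa [show (p * n + j - l : ℤ) - p * n = j - l by ring] at this
  have h2 : ((j : ℤ) - l).natAbs < p := by omega
  have h3 := Int.eq_zero_of_dvd_of_natAbs_lt_natAbs h1 (by simpa using h2)
  omega

theorem sect_single_mul_phi {j l : ℕ} (hj : j < p) (hl : l < p) (g : E⸨X⸩) :
    sect p E j (HahnSeries.single (l : ℤ) (1 : E) * phi p E g) = if j = l then g else 0 := by
  ext n
  rw [sect_coeff, single_mul_phi_coeff]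
  split_ifs with h
  · subst h
    rw [add_sub_cancel_right, phi_coeff_mul]
  · rw [phi_coeff_of_not_dvd p E _ (not_dvd_of_ne p hj hl h n), HahnSeries.coeff_zero]

theorem psi_single_mul_phi {l : ℕ} (hl : l < p) (g : E⸨X⸩) :
    psi p E (HahnSeries.single (l : ℤ) (1 : E) * phi p E g) = ((-1 : ℤ) ^ l) • g := by
  rw [psi_apply, Finset.sum_eq_single_of_mem l (Finset.mem_range.2 hl)]
  · rw [sect_single_mul_phi p hl hl, if_pos rfl]
  · intro j hj hjl
    rw [sect_single_mul_phi p (Finset.mem_range.1 hj) hl, if_neg hjl, smul_zero]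

theorem eq_sum_single_mul_phi (f : E⸨X⸩) :
    f = ∑ j ∈ Finset.range p, HahnSeries.single (j : ℤ) (1 : E) * phi p E (sect p E j f) := by
  have hp : (0 : ℤ) < p := by exact_mod_cast (Fact.out : p.Prime).pos
  ext n
  obtain ⟨j, hj⟩ : ∃ j : ℕ, (j : ℤ) = n % p := ⟨(n % p).toNat, Int.toNat_of_nonneg
    (Int.emod_nonneg _ hp.ne')⟩
  have hjp : j < p := by
    have := Int.emod_lt_of_pos n hp
    omega
  have hn : n = p * (n / p) + j := by rw [hj, Int.mul_ediv_add_emod]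
  rw [HahnSeries.coeff_sum, Finset.sum_eq_single_of_mem j (Finset.mem_range.2 hjp)]
  · rw [single_mul_phi_coeff]
    conv_rhs => rw [hn, add_sub_cancel_right, phi_coeff_mul, sect_coeff, ← hn]
  · intro l hl hlj
    rw [single_mul_phi_coeff, hn, phi_coeff_of_not_dvd]
    exact not_dvd_of_ne p hjp (Finset.mem_range.1 hl) hlj.symm _

/-- The map `ψ` is linear with respect to `φ`. -/
theorem psi_phi_mul (a f : E⸨X⸩) : psi p E (phi p E a * f) = a * psi p E f := by
  conv_lhs => rw [eq_sum_single_mul_phi p f]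
  conv_rhs => rw [eq_sum_single_mul_phi p f]
  simp_rw [Finset.mul_sum, map_sum, Finset.mul_sum]
  refine Finset.sum_congr rfl fun j hj => ?_
  rw [mul_left_comm, ← map_mul, psi_single_mul_phi p (Finset.mem_range.1 hj),
    psi_single_mul_phi p (Finset.mem_range.1 hj), mul_smul_comm]

theorem onePlus_eq : onePlus E = HahnSeries.single (1 : ℤ) 1 + 1 := by
  rw [onePlus, map_add, map_one, HahnSeries.ofPowerSeries_X, add_comm]

theorem psi_onePlus_pow {l : ℕ} (hl : l < p) : psi p E (onePlus E ^ l) = if l = 0 then 1 else 0 := by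
  rw [onePlus_eq, add_pow, map_sum]
  have h : ∀ i ∈ Finset.range (l + 1),
      psi p E (HahnSeries.single (1 : ℤ) (1 : E) ^ i * 1 ^ (l - i) * (l.choose i : E⸨X⸩))
        = (((-1) ^ i * (l.choose i : ℤ) : ℤ) : E⸨X⸩) := by
    intro i hi
    have hi' : i < p := by
      have := Finset.mem_range.1 hi
      omega
    have h1 := psi_single_mul_phi p (E := E) hi' 1
    rw [map_one (phi p E), mul_one] at h1
    rw [one_pow, mul_one, HahnSeries.single_pow, one_pow, mul_comm, ← nsmul_eq_mul, map_nsmul,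
      nsmul_one, h1]
    simp [mul_comm]
  rw [Finset.sum_congr rfl h, ← Int.cast_sum, Int.alternating_sum_range_choose]
  split_ifs <;> simp

/-- `E((X))` is generated by `1, 1+X, …, (1+X)^(p-1)` over the image of `φ`. -/
theorem induction_onePlus_phi {P : E⸨X⸩ → Prop} (hadd : ∀ f g, P f → P g → P (f + g))
    (h : ∀ l < p, ∀ g, P (onePlus E ^ l * phi p E g)) (f : E⸨X⸩) : P f := by
  have h0 : P 0 := by simpa using h 0 (Fact.out : p.Prime).pos 0
  rw [eq_sum_single_mul_phi p f]
  refine Finset.sum_induction _ P hadd h0 fun j hj => ?_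
  have hX : HahnSeries.single (j : ℤ) (1 : E) = (onePlus E - 1) ^ j := by
    rw [onePlus_eq, add_sub_cancel_right, HahnSeries.single_pow]
    simp
  rw [hX, sub_eq_add_neg, add_pow, Finset.sum_mul]
  refine Finset.sum_induction _ P hadd h0 fun i hi => ?_
  have hi' : i < p := by
    have := Finset.mem_range.1 hi
    have := Finset.mem_range.1 hj
    omega
  have := h i hi' ((-1) ^ (j - i) * (j.choose i : E⸨X⸩) * sect p E j f)
  rw [map_mul, map_mul, map_pow, map_neg, map_one, map_natCast] at this
  convert this using 1
  ring

theorem psi_phi (f : E⸨X⸩) : psi p E (phi p E f) = f := by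
  have h := psi_phi_mul p f 1
  have h1 := psi_onePlus_pow p (E := E) (Fact.out : p.Prime).pos
  rw [pow_zero, if_pos rfl] at h1
  rwa [mul_one, h1, mul_one] at h

theorem psi_onePlus_pow_mul_phi {l : ℕ} (hl : l < p) (g : E⸨X⸩) :
    psi p E (onePlus E ^ l * phi p E g) = if l = 0 then g else 0 := by
  rw [mul_comm, psi_phi_mul, psi_onePlus_pow p hl]
  split_ifs <;> simp

/-- If `a ≡ 1` modulo `p`, then `a · (1+X)^l` is `(1+X)^l` times an element of the image of `φ`;
this is why `ψ` commutes with `a`. It is stated for the elements `a = 1 + p^s` only. -/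
theorem psi_sigma [CharP E p] {a : ℤ_[p]ˣ} {s : ℕ} (hs : s ≠ 0)
    (ha : (a : ℤ_[p]) = 1 + (p : ℤ_[p]) ^ s) (f : E⸨X⸩) :
    psi p E (sigma p E a f) = sigma p E a (psi p E f) := by
  refine induction_onePlus_phi p
    (P := fun f => psi p E (sigma p E a f) = sigma p E a (psi p E f))
    (fun f g hf hg => by simp only [map_add, hf, hg]) ?_ f
  intro l hl g
  have h1 : onePlus E ^ p ^ s = phi p E (onePlus E ^ p ^ (s - 1)) := by
    rw [map_pow, phi_onePlus, ← pow_mul, ← pow_succ', Nat.sub_add_cancel (by omega)]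
  have h2 : sigma p E a (onePlus E ^ l * phi p E g)
      = onePlus E ^ l * phi p E ((onePlus E ^ p ^ (s - 1)) ^ l * sigma p E a g) := by
    rw [map_mul, map_pow, sigma_onePlus_of_eq p ha, mul_pow, h1, sigma_phi, map_mul (phi p E),
      map_pow (phi p E) _ l, mul_assoc]
  rw [h2, psi_onePlus_pow_mul_phi p hl, psi_onePlus_pow_mul_phi p hl]
  split_ifs with h0
  · subst h0
    simp
  · simp

/-- The reconstruction of `f` from its components in the basis `1, (1+X)⁻¹, …, (1+X)^(1-p)` of
`E((X))` over the image of `φ`. -/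
theorem eq_sum_phi_psi [CharP E p] (f : E⸨X⸩) :
    f = ∑ j ∈ Finset.range p, (onePlus E ^ j)⁻¹ * phi p E (psi p E (onePlus E ^ j * f)) := by
  refine induction_onePlus_phi p (P := fun f =>
    f = ∑ j ∈ Finset.range p, (onePlus E ^ j)⁻¹ * phi p E (psi p E (onePlus E ^ j * f))) ?_ ?_ f
  · intro f g hf hg
    simp only [mul_add, map_add, Finset.sum_add_distrib]
    rw [← hf, ← hg]
  intro l hl g
  have hp0 := (Fact.out : p.Prime).pos
  have hw := onePlus_ne_zero E
  obtain ⟨i, hip, hi⟩ : ∃ i < p, (l = 0 ∧ i = 0) ∨ (i + l = p) := by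
    rcases Nat.eq_zero_or_pos l with h | h
    · exact ⟨0, hp0, Or.inl ⟨h, rfl⟩⟩
    · exact ⟨p - l, by omega, Or.inr (by omega)⟩
  -- only the index `i` with `i + l ≡ 0` modulo `p` contributes
  rw [Finset.sum_eq_single_of_mem i (Finset.mem_range.2 hip)]
  · rcases hi with ⟨rfl, rfl⟩ | hi
    · simp [psi_phi]
    · rw [← mul_assoc, ← pow_add, hi, ← phi_onePlus p E, ← map_mul, psi_phi, map_mul, phi_onePlus]
      conv_rhs => enter [2, 1, 2]; rw [← hi]
      rw [pow_add]
      field_simp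
  · intro j hj hji
    have hj := Finset.mem_range.1 hj
    rw [← mul_assoc, ← pow_add]
    have : psi p E (onePlus E ^ (j + l) * phi p E g) = 0 := by
      by_cases hjl : j + l < p
      · rw [psi_onePlus_pow_mul_phi p hjl, if_neg (by omega)]
      · have h1 : onePlus E ^ (j + l) * phi p E g
            = onePlus E ^ (j + l - p) * phi p E (onePlus E * g) := by
          rw [map_mul, phi_onePlus, ← mul_assoc, ← pow_add, Nat.sub_add_cancel (by omega)]
        rw [h1, psi_onePlus_pow_mul_phi p (by omega), if_neg (by omega)]
    rw [this, map_zero, mul_zero]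

/-! ### The iterates of `ψ` -/

/-- The map `ψ` divides valuations by `p`, up to rounding down to an integer. This is why the bound
`d` is an integer here. -/
theorem LGE.psi {d : ℤ} {f : E⸨X⸩} (h : LGE ((p : ℝ) * d) f) : LGE (d : ℝ) (psi p E f) := by
  have h' : LGE (((p * d : ℤ)) : ℝ) f := by exact_mod_cast h
  rw [LGE_intCast] at *
  intro n hn
  rw [psi_apply, HahnSeries.coeff_sum]
  refine Finset.sum_eq_zero fun j hj => ?_
  have hj := Finset.mem_range.1 hj
  rw [HahnSeries.coeff_smul, sect_coeff, h', smul_zero]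
  have : (p : ℤ) * (n + 1) ≤ p * d := mul_le_mul_of_nonneg_left (by omega) (by omega)
  have hj' : (j : ℤ) < p := by exact_mod_cast hj
  linarith

theorem LGE.psi_iterate {d : ℤ} (n : ℕ) {f : E⸨X⸩} (h : LGE ((p : ℝ) ^ n * d) f) :
    LGE (d : ℝ) ((SuperHolder.psi p E)^[n] f) := by
  induction n generalizing f with
  | zero => simpa using h
  | succ n ih =>
    rw [Function.iterate_succ_apply]
    apply ih
    have := LGE.psi p (d := p ^ n * d) (f := f) (h.mono (by push_cast; rw [pow_succ']; linarith))
    exact_mod_cast this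

theorem phi_iterate_mul (n : ℕ) (f g : E⸨X⸩) :
    (phi p E)^[n] (f * g) = (phi p E)^[n] f * (phi p E)^[n] g := iterate_map_mul _ n f g

theorem psi_iterate_add (n : ℕ) (f g : E⸨X⸩) :
    (psi p E)^[n] (f + g) = (psi p E)^[n] f + (psi p E)^[n] g := iterate_map_add _ n f g

theorem psi_iterate_sub (n : ℕ) (f g : E⸨X⸩) :
    (psi p E)^[n] (f - g) = (psi p E)^[n] f - (psi p E)^[n] g := iterate_map_sub _ n f g

theorem psi_iterate_phi_mul (n : ℕ) (a f : E⸨X⸩) :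
    (psi p E)^[n] ((phi p E)^[n] a * f) = a * (psi p E)^[n] f := by
  induction n generalizing f with
  | zero => rfl
  | succ n ih =>
    rw [Function.iterate_succ_apply, Function.iterate_succ_apply', psi_phi_mul, ih,
      ← Function.iterate_succ_apply (psi p E)]

theorem psi_iterate_phi (n j : ℕ) (f : E⸨X⸩) :
    (psi p E)^[n + j] ((phi p E)^[j] f) = (psi p E)^[n] f := by
  induction j with
  | zero => rfl
  | succ j ih =>
    rw [← add_assoc, Function.iterate_succ_apply, Function.iterate_succ_apply' (phi p E), psi_phi,
      ih]

variable [CharP E p]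

theorem psi_iterate_sigma {a : ℤ_[p]ˣ} {s : ℕ} (hs : s ≠ 0)
    (ha : (a : ℤ_[p]) = 1 + (p : ℤ_[p]) ^ s) (n : ℕ) (f : E⸨X⸩) :
    (psi p E)^[n] (sigma p E a f) = sigma p E a ((psi p E)^[n] f) := by
  induction n with
  | zero => rfl
  | succ n ih => rw [Function.iterate_succ_apply', ih, psi_sigma p hs ha,
      ← Function.iterate_succ_apply' (psi p E)]

theorem phi_iterate_onePlus (n : ℕ) : (phi p E)^[n] (onePlus E) = onePlus E ^ p ^ n := by
  induction n with
  | zero => simp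
  | succ n ih => rw [Function.iterate_succ_apply', ih, map_pow, phi_onePlus, ← pow_mul, pow_succ']

theorem phi_iterate_onePlus_pow (n j : ℕ) :
    (phi p E)^[n] (onePlus E ^ j) = onePlus E ^ (p ^ n * j) := by
  rw [iterate_map_pow, phi_iterate_onePlus, pow_mul]

theorem phi_iterate_onePlus_pow_inv (n j : ℕ) :
    (phi p E)^[n] (onePlus E ^ j)⁻¹ = (onePlus E ^ (p ^ n * j))⁻¹ := by
  rw [← phi_iterate_onePlus_pow]
  induction n with
  | zero => rfl
  | succ n ih => rw [Function.iterate_succ_apply', ih, map_inv₀, ← Function.iterate_succ_apply' (phi p E)]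

omit [Fact p.Prime] [CharP E p] in
theorem sum_range_sum_range_mul_add {A : Type*} [AddCommMonoid A] (a b : ℕ) (G : ℕ → A) :
    ∑ j ∈ Finset.range a, ∑ l ∈ Finset.range b, G (a * l + j) = ∑ i ∈ Finset.range (a * b), G i := by
  rw [Finset.sum_comm]
  induction b with
  | zero => simp
  | succ b ih => rw [Finset.sum_range_succ, ih, mul_add, mul_one, Finset.sum_range_add]

/-- The reconstruction of `f` from its components in the basis `(1+X)^(-j)`, `0 ≤ j < p^n`, of
`E((X))` over the image of `φ^n`. -/
theorem eq_sum_phi_psi_iterate (n : ℕ) (f : E⸨X⸩) :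
    f = ∑ j ∈ Finset.range (p ^ n),
      (onePlus E ^ j)⁻¹ * (phi p E)^[n] ((psi p E)^[n] (onePlus E ^ j * f)) := by
  induction n with
  | zero => simp
  | succ n ih =>
    conv_lhs => rw [ih]
    rw [pow_succ, ← sum_range_sum_range_mul_add]
    refine Finset.sum_congr rfl fun j _ => ?_
    conv_lhs => rw [eq_sum_phi_psi p ((psi p E)^[n] (onePlus E ^ j * f))]
    rw [← RingHom.coe_pow, map_sum, Finset.mul_sum]
    refine Finset.sum_congr rfl fun l _ => ?_
    rw [RingHom.coe_pow, phi_iterate_mul, phi_iterate_onePlus_pow_inv, ← psi_iterate_phi_mul,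
      phi_iterate_onePlus_pow, ← mul_assoc (onePlus E ^ (p ^ n * l)), ← pow_add,
      ← Function.iterate_succ_apply, ← Function.iterate_succ_apply' (psi p E), pow_add, mul_inv]
    ring

end Psi

/-! ### The projection of `Ẽ` onto `E((X))` -/

section Tate

variable {p : ℕ} [Fact p.Prime] {E : Type*} [Field E]

theorem exists_approx (f : Etilde p E) (r : ℝ) :
    ∃ (n : ℕ) (y : E⸨X⸩), HGE r ((f : HahnSeries ℚ E) - emb p E n y) := by
  obtain ⟨c, hc⟩ := exists_rat_gt r
  obtain ⟨n, y, h⟩ := f.2 c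
  exact ⟨n, y, (HGE_iff_VG.2 h).mono hc.le⟩

/-- The maps `y(X^{1/p^n}) ↦ ψ^n(y)(X)` are compatible for varying `n`, and continuous. -/
theorem LGE_psi_iterate_sub {d : ℤ} {n n' : ℕ} {y y' : E⸨X⸩}
    (h : HGE (d : ℝ) (emb p E n y - emb p E n' y')) :
    LGE (d : ℝ) ((psi p E)^[n] y - (psi p E)^[n'] y') := by
  obtain ⟨N, j, j', e, e', rfl, h2⟩ := emb_common p n n' y y'
  rw [e, e', ← map_sub, HGE_emb] at h
  have := LGE.psi_iterate p (n + j) (h.mono (mul_comm _ _).le)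
  rwa [psi_iterate_sub, psi_iterate_phi, h2, psi_iterate_phi] at this

theorem eq_of_LGE_sub {f g : E⸨X⸩} (h : ∀ d : ℤ, LGE (d : ℝ) (f - g)) : f = g :=
  sub_eq_zero.1 (eq_zero_of_LGE fun r => (h ⌈r⌉).mono (Int.le_ceil r))

/-- The series whose `m`-th coefficient is that of `ψ^n y`, for any approximation `emb n y` of `f`
modulo `X^(m+1)`. -/
def tateAux (f : Etilde p E) : E⸨X⸩ :=
  HahnSeries.ofSuppBddBelow (fun m : ℤ => ((psi p E)^[(exists_approx f (m + 1)).choose]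
    (exists_approx f (m + 1)).choose_spec.choose).coeff m) (by
    obtain ⟨r, hr⟩ := exists_HGE (f : HahnSeries ℚ E)
    refine ⟨⌊r⌋, fun m hm => ?_⟩
    by_contra! hlt
    refine hm ?_
    have h1 := (exists_approx f (m + 1)).choose_spec.choose_spec
    have h2 : ((m : ℝ) + 1) ≤ r := by
      have : m + 1 ≤ ⌊r⌋ := hlt
      exact_mod_cast Int.le_floor.1 this
    have h3 := (hr.mono h2).sub h1
    rw [sub_sub_cancel] at h3
    have h4 := LGE_psi_iterate_sub (p := p) (E := E) (d := m + 1) (n' := 0) (y' := 0)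
      (by simpa using h3)
    simpa using h4 m (by simp))

theorem LGE_tateAux_sub {d : ℤ} {n : ℕ} {y : E⸨X⸩} {f : Etilde p E}
    (h : HGE (d : ℝ) ((f : HahnSeries ℚ E) - emb p E n y)) :
    LGE (d : ℝ) (tateAux f - (psi p E)^[n] y) := by
  rw [LGE_intCast]
  intro m hm
  have h1 := (exists_approx f (m + 1)).choose_spec.choose_spec
  have h2 : (m : ℝ) + 1 ≤ d := by exact_mod_cast hm
  have h3 := (h.mono h2).sub h1
  rw [sub_sub_sub_cancel_left] at h3
  have h4 := LGE_psi_iterate_sub (p := p) (E := E) (d := m + 1)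
    (h3.mono (by push_cast; exact le_rfl))
  have h5 := h4 m (by simp)
  rw [HahnSeries.coeff_sub] at h5 ⊢
  exact h5

variable (p E) in
/-- The `E((X))`-linear projection `Ẽ → E((X))` extending the maps `f(X^{1/p^n}) ↦ ψ^n(f)(X)` by
continuity: it gives the component of index `0` in the expansion of an element of `Ẽ` along the
`(1+X)^i` with `i ∈ ℤ[1/p] ∩ [0, 1)`. -/
def tate : Etilde p E →ₗ[E⸨X⸩] E⸨X⸩ where
  toFun := tateAux
  map_add' f g := by
    refine eq_of_LGE_sub fun d => ?_
    obtain ⟨n, y, hy⟩ := exists_approx f d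
    obtain ⟨n', y', hy'⟩ := exists_approx g d
    obtain ⟨N, j, j', e, e', rfl, h2⟩ := emb_common p n n' y y'
    have h1 : HGE (d : ℝ) (((f + g : Etilde p E) : HahnSeries ℚ E)
        - emb p E (n + j) ((phi p E)^[j] y + (phi p E)^[j'] y')) := by
      rw [map_add, ← e, ← e']
      convert hy.add hy' using 1
      push_cast
      ring
    have h3 := LGE_tateAux_sub h1
    rw [psi_iterate_add, psi_iterate_phi, h2, psi_iterate_phi] at h3
    convert h3.sub ((LGE_tateAux_sub hy).add (LGE_tateAux_sub hy')) using 1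
    ring
  map_smul' a f := by
    -- the precision `D` accounts for the loss of precision in the product with `a`
    refine eq_of_LGE_sub fun d => ?_
    obtain ⟨D, hD1, hD2⟩ : ∃ D : ℤ, d ≤ D ∧ d ≤ D + a.order :=
      ⟨max d (d - a.order), le_max_left _ _, by have := le_max_right d (d - a.order); omega⟩
    have hD2' : (d : ℝ) ≤ a.order + D := by exact_mod_cast (by omega : d ≤ a.order + D)
    obtain ⟨n, y, hy⟩ := exists_approx f D
    have ha : HGE (a.order : ℝ) (emb p E 0 a) := (HGE_emb p).2 (by simpa using LGE_order a)
    have h1 : HGE (d : ℝ) (((a • f : Etilde p E) : HahnSeries ℚ E)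
        - emb p E n ((phi p E)^[n] a * y)) := by
      have e := emb_phi_iterate p E 0 n a
      rw [zero_add] at e
      rw [map_mul, e, Algebra.smul_def]
      convert (ha.mul hy).mono hD2' using 1
      rw [mul_sub]
      rfl
    have h3 := LGE_tateAux_sub h1
    rw [psi_iterate_phi_mul] at h3
    have h4 := ((LGE_order a).mul (LGE_tateAux_sub hy)).mono hD2'
    convert h3.sub h4 using 1
    simp only [RingHom.id_apply, smul_eq_mul]
    ring

theorem LGE_tate_sub {d : ℤ} {n : ℕ} {y : E⸨X⸩} {f : Etilde p E}
    (h : HGE (d : ℝ) ((f : HahnSeries ℚ E) - emb p E n y)) :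
    LGE (d : ℝ) (tate p E f - (psi p E)^[n] y) := LGE_tateAux_sub h

theorem LGE_tate_intCast {d : ℤ} {f : Etilde p E} (h : HGE (d : ℝ) (f : HahnSeries ℚ E)) :
    LGE (d : ℝ) (tate p E f) := by
  simpa using LGE_tate_sub (f := f) (n := 0) (y := 0) (by simpa using h)

theorem LGE_tate {r : ℝ} {f : Etilde p E} (h : HGE r (f : HahnSeries ℚ E)) :
    LGE (r - 1) (tate p E f) :=
  (LGE_tate_intCast (h.mono (Int.floor_le r))).mono (Int.sub_one_lt_floor r).le

variable (p E) in
/-- The element `f(X^{1/p^n})` of `Ẽ`. -/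
def embTilde (n : ℕ) (f : E⸨X⸩) : Etilde p E := ⟨emb p E n f, emb_mem p E n f⟩

theorem embTilde_mul (n : ℕ) (f g : E⸨X⸩) :
    embTilde p E n (f * g) = embTilde p E n f * embTilde p E n g := Subtype.ext (map_mul _ _ _)

theorem embTilde_phi_iterate (n j : ℕ) (f : E⸨X⸩) :
    embTilde p E (n + j) ((phi p E)^[j] f) = embTilde p E n f := Subtype.ext (emb_phi_iterate ..)

theorem embTilde_zero (f : E⸨X⸩) : embTilde p E 0 f = algebraMap E⸨X⸩ (Etilde p E) f := rfl

variable [CharP E p]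

theorem sigmaTilde_embTilde (a : ℤ_[p]ˣ) (n : ℕ) (f : E⸨X⸩) :
    sigmaTilde p E a (embTilde p E n f) = embTilde p E n (sigma p E a f) :=
  Subtype.ext (IsExt.unique p E (sigmaTilde_isExt p E a _) (isExt_emb p E a n f))

theorem sigmaTilde_one (f : Etilde p E) : sigmaTilde p E 1 f = f := by
  refine Subtype.ext (IsExt.unique p E (sigmaTilde_isExt p E 1 f) fun c => ?_)
  obtain ⟨n, y, h⟩ := f.2 c
  exact ⟨n, y, h, by rwa [sigma_one]⟩

theorem tate_sigmaTilde {a : ℤ_[p]ˣ} {s : ℕ} (hs : s ≠ 0)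
    (ha : (a : ℤ_[p]) = 1 + (p : ℤ_[p]) ^ s) (f : Etilde p E) :
    tate p E (sigmaTilde p E a f) = sigma p E a (tate p E f) := by
  refine eq_of_LGE_sub fun d => ?_
  obtain ⟨n, y, h1, h2⟩ := sigmaTilde_isExt p E a f d
  rw [← HGE_iff_VG] at h1 h2
  have h3 := LGE_tate_sub (by exact_mod_cast h1)
  have h4 := LGE_tate_sub (by exact_mod_cast h2)
  rw [psi_iterate_sigma p hs ha] at h4
  convert h4.sub (h3.sigma p a) using 1
  rw [map_sub]
  ring

end Tate

/-! ### Recognizing the elements of `E((X^{1/p^m}))` -/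

section Detect

variable {p : ℕ} [Fact p.Prime] {E : Type*} [Field E]

/-- The field `E((X^{1/p^m}))` is closed in `Ẽ`. -/
theorem mem_Elevel_of_approx {m : ℕ} {f : Etilde p E}
    (h : ∀ r : ℝ, ∃ y : E⸨X⸩, HGE r ((f : HahnSeries ℚ E) - emb p E m y)) : f ∈ Elevel p E m := by
  have hp : (0 : ℚ) < ((p : ℚ) ^ m)⁻¹ :=
    inv_pos.2 (pow_pos (by exact_mod_cast (Fact.out : p.Prime).pos) _)
  obtain ⟨c, -, hc⟩ := exists_VG (f : HahnSeries ℚ E)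
  rw [VG_iff] at hc
  refine ⟨HahnSeries.ofSuppBddBelow (fun j : ℤ => (f : HahnSeries ℚ E).coeff
    (((p : ℚ) ^ m)⁻¹ * j)) ⟨⌊c / ((p : ℚ) ^ m)⁻¹⌋, fun j hj => ?_⟩, ?_⟩
  · by_contra! hlt
    refine hj (hc _ ?_)
    have := (Int.lt_iff_add_one_le.1 hlt)
    have h2 : (j : ℚ) < c / ((p : ℚ) ^ m)⁻¹ := by
      have h3 := Int.le_floor.1 this
      push_cast at h3
      linarith
    rw [lt_div_iff₀ hp] at h2
    linarith
  · ext q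
    by_cases hq : ∃ j : ℤ, ((p : ℚ) ^ m)⁻¹ * j = q
    · obtain ⟨j, rfl⟩ := hq
      rw [emb_coeff_div]
      rfl
    · obtain ⟨y, hy⟩ := h (q + 1)
      have := hy q (by
        change (q : ℝ) < q + 1
        linarith)
      rw [HahnSeries.coeff_sub, emb_coeff_of_forall_ne p E m y fun j hj => hq ⟨j, hj⟩,
        sub_zero] at this
      rw [this, emb_coeff_of_forall_ne p E m _ fun j hj => hq ⟨j, hj⟩]

variable [CharP E p]

/-- An element of `Ẽ` belongs to `E((X^{1/p^m}))` if it has no component along `(1+X)^i` for the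
`i ∈ ℤ[1/p]` whose denominator does not divide `p^m`. -/
theorem mem_Elevel_of_tate_eq_zero {m : ℕ} {f : Etilde p E}
    (h : ∀ n j : ℕ, m ≤ n → ¬ p ^ (n - m) ∣ j →
      tate p E (embTilde p E n (onePlus E ^ j) * f) = 0) : f ∈ Elevel p E m := by
  refine mem_Elevel_of_approx fun r => ?_
  obtain ⟨n₀, y₀, hy₀⟩ := exists_approx f ⌈r⌉
  obtain ⟨n, y, hmn, hy⟩ : ∃ (n : ℕ) (y : E⸨X⸩), m ≤ n ∧
      HGE (⌈r⌉ : ℝ) ((f : HahnSeries ℚ E) - emb p E n y) :=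
    ⟨n₀ + m, (phi p E)^[m] y₀, Nat.le_add_left _ _, by rwa [emb_phi_iterate]⟩
  -- the terms of the expansion of `y` that do not belong to `φ^(n-m)(E((X)))` are small
  have hsmall : ∀ j, ¬ p ^ (n - m) ∣ j →
      HGE r (emb p E n ((onePlus E ^ j)⁻¹ * (phi p E)^[n] ((psi p E)^[n] (onePlus E ^ j * y)))) := by
    intro j hj
    have h1 : HGE (⌈r⌉ : ℝ) (((embTilde p E n (onePlus E ^ j) * f : Etilde p E) : HahnSeries ℚ E)
        - emb p E n (onePlus E ^ j * y)) := by
      have h2 : HGE 0 (emb p E n (onePlus E ^ j)) := by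
        rw [HGE_emb, zero_mul]
        exact (LGE_onePlus_pow j).1
      rw [map_mul]
      convert (h2.mul hy).mono (zero_add _).ge using 1
      rw [mul_sub]
      rfl
    have h3 := LGE_tate_sub h1
    rw [h n j hmn hj, zero_sub] at h3
    have h4 := h3.neg
    rw [neg_neg] at h4
    have h5 : HGE (⌈r⌉ : ℝ) (emb p E n ((phi p E)^[n] ((psi p E)^[n] (onePlus E ^ j * y)))) := by
      have e := emb_phi_iterate p E 0 n ((psi p E)^[n] (onePlus E ^ j * y))
      rw [zero_add] at e
      rw [e, HGE_emb]
      simpa using h4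
    have h6 : HGE 0 (emb p E n (onePlus E ^ j)⁻¹) := by
      rw [HGE_emb, zero_mul]
      exact (LGE_onePlus_pow j).2
    rw [map_mul]
    exact (h6.mul h5).mono (by linarith [Int.le_ceil r])
  -- the other terms belong to `φ^(n-m)(E((X)))`
  have hbig : ∀ j, p ^ (n - m) ∣ j → ∃ z, emb p E n ((onePlus E ^ j)⁻¹ *
      (phi p E)^[n] ((psi p E)^[n] (onePlus E ^ j * y))) = emb p E m z := by
    rintro _ ⟨j, rfl⟩
    refine ⟨(onePlus E ^ j)⁻¹ * (phi p E)^[m] ((psi p E)^[n] (onePlus E ^ (p ^ (n - m) * j) * y)),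
      ?_⟩
    rw [← emb_phi_iterate p E m (n - m), phi_iterate_mul, phi_iterate_onePlus_pow_inv,
      ← Function.iterate_add_apply, Nat.sub_add_cancel hmn, Nat.add_sub_cancel' hmn]
  choose! z hz using hbig
  refine ⟨∑ j ∈ (Finset.range (p ^ n)).filter (p ^ (n - m) ∣ ·), z j, ?_⟩
  have h1 : emb p E n y - emb p E m (∑ j ∈ (Finset.range (p ^ n)).filter (p ^ (n - m) ∣ ·), z j)
      = ∑ j ∈ (Finset.range (p ^ n)).filter (¬ p ^ (n - m) ∣ ·),
        emb p E n ((onePlus E ^ j)⁻¹ * (phi p E)^[n] ((psi p E)^[n] (onePlus E ^ j * y))) := by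
    conv_lhs => rw [eq_sum_phi_psi_iterate p n y]
    rw [map_sum, map_sum, ← Finset.sum_filter_add_sum_filter_not (Finset.range (p ^ n))
      (p ^ (n - m) ∣ ·), Finset.sum_congr rfl fun j hj => hz j (Finset.mem_filter.1 hj).2,
      add_sub_cancel_left]
  have h2 := ValGE.sum (t := (Finset.range (p ^ n)).filter (¬ p ^ (n - m) ∣ ·)) fun j hj => hsmall j (Finset.mem_filter.1 hj).2
  rw [← h1] at h2
  convert (hy.mono (Int.le_ceil r)).add h2 using 1
  ring

end Detect

/-! ### Valuations on `M` and on `Ẽ ⊗ M` -/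

section ModuleVal

variable {p : ℕ} [Fact p.Prime] {E : Type*} [Field E]
  {M : Type*} [AddCommGroup M] [Module E⸨X⸩ M] {ι : Type*}

/-- The valuation of `m`, for the basis `b` of `M`, is at least `r`. -/
def MGE (b : Module.Basis ι E⸨X⸩ M) (r : ℝ) (m : M) : Prop := ∀ i, LGE r (b.repr m i)

variable (p) in
/-- The valuation of `x ∈ Ẽ ⊗ M`, for the basis `b` of `M`, is at least `r`. -/
def TGE (b : Module.Basis ι E⸨X⸩ M) (r : ℝ) (x : Etilde p E ⊗[E⸨X⸩] M) : Prop :=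
  ∀ i, HGE r (((b.baseChange (Etilde p E)).repr x i : Etilde p E) : HahnSeries ℚ E)

variable {b : Module.Basis ι E⸨X⸩ M} {r s : ℝ}

theorem le_basisVal_valE_iff {m : M} : (r : EReal) ≤ basisVal valE b m ↔ MGE b r m := by
  simp_rw [basisVal, le_iInf_iff, le_valE_iff, MGE]

theorem le_basisVal_valEtilde_iff {x : Etilde p E ⊗[E⸨X⸩] M} :
    (r : EReal) ≤ basisVal (valEtilde p E) (b.baseChange (Etilde p E)) x ↔ TGE p b r x := by
  simp_rw [basisVal, le_iInf_iff, le_valEtilde_iff, TGE]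

namespace MGE

variable {m m' : M}

theorem mono (h : MGE b s m) (hrs : r ≤ s) : MGE b r m := fun i => (h i).mono hrs

theorem zero (r : ℝ) : MGE b r 0 := fun i => by
  rw [map_zero]
  exact ValGE.zero r

theorem add (h : MGE b r m) (h' : MGE b r m') : MGE b r (m + m') := fun i => by
  rw [map_add]
  exact (h i).add (h' i)

theorem sub (h : MGE b r m) (h' : MGE b r m') : MGE b r (m - m') := fun i => by
  rw [map_sub]
  exact (h i).sub (h' i)

theorem smul {f : E⸨X⸩} (hf : LGE r f) (h : MGE b s m) : MGE b (r + s) (f • m) := fun i => by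
  rw [map_smul]
  exact hf.mul (h i)

theorem sum {κ : Type*} {t : Finset κ} {F : κ → M} (h : ∀ i ∈ t, MGE b r (F i)) :
    MGE b r (∑ i ∈ t, F i) :=
  Finset.sum_induction _ _ (fun _ _ => add) (zero r) h

theorem basis (i : ι) : MGE b 0 (b i) := fun j => by
  classical
  rw [Module.Basis.repr_self, Finsupp.single_apply]
  split_ifs
  · exact ValGE.one
  · exact ValGE.zero 0

end MGE

theorem eq_zero_of_MGE {m : M} (h : ∀ r, MGE b r m) : m = 0 :=
  b.ext_elem fun i => by simpa using eq_zero_of_LGE fun r => h r i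

theorem exists_MGE [Finite ι] (b : Module.Basis ι E⸨X⸩ M) (m : M) : ∃ r, MGE b r m := by
  have hfin : (Set.range fun i => ((b.repr m i).order : ℝ)).Finite := Set.finite_range _
  obtain ⟨r, hr⟩ := hfin.bddBelow
  exact ⟨r, fun i => (LGE_order _).mono (hr ⟨i, rfl⟩)⟩

namespace TGE

variable {x y : Etilde p E ⊗[E⸨X⸩] M}

theorem mono (h : TGE p b s x) (hrs : r ≤ s) : TGE p b r x := fun i => (h i).mono hrs

theorem zero (r : ℝ) : TGE p b r 0 := fun i => by
  rw [map_zero]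
  exact ValGE.zero r

theorem add (h : TGE p b r x) (h' : TGE p b r y) : TGE p b r (x + y) := fun i => by
  rw [map_add]
  exact (h i).add (h' i)

theorem smul {f : Etilde p E} (hf : HGE r (f : HahnSeries ℚ E)) (h : TGE p b s x) :
    TGE p b (r + s) (f • x) := fun i => by
  rw [map_smul]
  exact hf.mul (h i)

theorem tmul {f : Etilde p E} {m : M} (hf : HGE r (f : HahnSeries ℚ E)) (hm : MGE b s m) :
    TGE p b (r + s) (f ⊗ₜ[E⸨X⸩] m) := fun i => by
  rw [Module.Basis.baseChange_repr_tmul, Algebra.smul_def, mul_comm]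
  exact hf.mul ((HGE_emb p).2 (by simpa using hm i))

end TGE

/-- The elements of `V ⊗ M` are those whose coordinates belong to `V`. -/
theorem mem_subTensor_iff [Fintype ι] (b : Module.Basis ι E⸨X⸩ M)
    {V : Submodule E⸨X⸩ (Etilde p E)} {x : Etilde p E ⊗[E⸨X⸩] M} :
    x ∈ subTensor p M V ↔ ∀ i, (b.baseChange (Etilde p E)).repr x i ∈ V := by
  constructor
  · rintro ⟨t, rfl⟩ i
    induction t with
    | zero => simp
    | tmul v m =>
      rw [LinearMap.rTensor_tmul, Module.Basis.baseChange_repr_tmul]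
      exact V.smul_mem _ v.2
    | add t t' h h' =>
      rw [map_add, map_add]
      exact V.add_mem h h'
  · intro h
    refine ⟨∑ i, (⟨_, h i⟩ : V) ⊗ₜ[E⸨X⸩] b i, ?_⟩
    conv_rhs => rw [← (b.baseChange (Etilde p E)).sum_repr x]
    rw [map_sum]
    refine Finset.sum_congr rfl fun i _ => ?_
    rw [LinearMap.rTensor_tmul, Module.Basis.baseChange_apply, TensorProduct.smul_tmul', smul_eq_mul,
      mul_one]
    rfl

/-! ### The projection of `Ẽ ⊗ M` onto `M` -/

variable (p M) in
/-- The projection `Ẽ ⊗ M → M` deduced from the projection of `Ẽ` onto `E((X))`. -/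
def tateM : Etilde p E ⊗[E⸨X⸩] M →ₗ[E⸨X⸩] M :=
  (TensorProduct.lid E⸨X⸩ M).toLinearMap ∘ₗ (tate p E).rTensor M

theorem tateM_tmul (f : Etilde p E) (m : M) : tateM p M (f ⊗ₜ m) = tate p E f • m := by
  simp [tateM]

theorem repr_tateM (x : Etilde p E ⊗[E⸨X⸩] M) (i : ι) :
    b.repr (tateM p M x) i = tate p E ((b.baseChange (Etilde p E)).repr x i) := by
  induction x with
  | zero => simp
  | tmul f m => rw [tateM_tmul, Module.Basis.baseChange_repr_tmul, map_smul, map_smul,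
      Finsupp.smul_apply, smul_eq_mul, smul_eq_mul, mul_comm]
  | add x y hx hy => simp only [map_add, Finsupp.add_apply, hx, hy]

theorem TGE.tateM {x : Etilde p E ⊗[E⸨X⸩] M} (h : TGE p b r x) :
    MGE b (r - 1) (tateM p M x) := fun i => by
  rw [repr_tateM]
  exact LGE_tate (h i)

end ModuleVal

/-! ### The group `Γ_k` and its semilinear actions -/

section Action

variable {p : ℕ} [Fact p.Prime] {k : ℕ} (hk : 1 ≤ k)

theorem coordInv_val (z : ℤ_[p]) :
    ((coordInv p k hk z : ℤ_[p]ˣ) : ℤ_[p]) = 1 + (p : ℤ_[p]) ^ k * z := rfl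

theorem coordInv_zero : coordInv p k hk 0 = 1 := by
  ext
  simp [coordInv_val]

theorem coordInv_pow_val (i : ℕ) :
    ((coordInv p k hk ((p : ℤ_[p]) ^ i) : ℤ_[p]ˣ) : ℤ_[p]) = 1 + (p : ℤ_[p]) ^ (k + i) := by
  rw [coordInv_val, pow_add]

theorem coordInv_surjective (g : Gam p k) : ∃ z, coordInv p k hk z = g := by
  obtain ⟨z, hz⟩ := g.2
  refine ⟨z, ?_⟩
  ext
  rw [coordInv_val, ← hz]
  ring

theorem pow_dvd_coordInv_sub {i : ℕ} {y z : ℤ_[p]} (h : (p : ℤ_[p]) ^ i ∣ y - z) :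
    (p : ℤ_[p]) ^ (k + i) ∣
      ((coordInv p k hk y : ℤ_[p]ˣ) : ℤ_[p]) - ((coordInv p k hk z : ℤ_[p]ˣ) : ℤ_[p]) := by
  rw [coordInv_val, coordInv_val, add_sub_add_left_eq_sub, ← mul_sub, pow_add]
  exact mul_dvd_mul_left _ h

variable {E : Type*} [Field E] [CharP E p]
  {M : Type*} [AddCommGroup M] [Module E⸨X⸩ M] [DistribMulAction (Gam p k) M]
  (hM : IsSemilinear p E k M)

theorem tensorAct_one (x : Etilde p E ⊗[E⸨X⸩] M) : tensorAct p k hM 1 x = x := by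
  induction x with
  | zero => simp
  | tmul f m =>
    rw [tensorAct_tmul, one_smul]
    exact congrArg (· ⊗ₜ[E⸨X⸩] m) (sigmaTilde_one f)
  | add x y hx hy => rw [map_add, hx, hy]

theorem tensorAct_smul (g : Gam p k) (f : Etilde p E) (x : Etilde p E ⊗[E⸨X⸩] M) :
    tensorAct p k hM g (f • x) = sigmaTilde p E g f • tensorAct p k hM g x := by
  induction x with
  | zero => simp
  | tmul f' m => rw [TensorProduct.smul_tmul', smul_eq_mul, tensorAct_tmul, tensorAct_tmul, map_mul,
      TensorProduct.smul_tmul', smul_eq_mul]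
  | add x y hx hy => rw [smul_add, map_add, hx, hy, map_add, smul_add]

theorem tateM_tensorAct {g : Gam p k} {s : ℕ} (hs : s ≠ 0)
    (hg : ((g : ℤ_[p]ˣ) : ℤ_[p]) = 1 + (p : ℤ_[p]) ^ s) (x : Etilde p E ⊗[E⸨X⸩] M) :
    tateM p M (tensorAct p k hM g x) = g • tateM p M x := by
  induction x with
  | zero => simp
  | tmul f m => rw [tensorAct_tmul, tateM_tmul, tateM_tmul, hM, tate_sigmaTilde hs hg]
  | add x y hx hy => rw [map_add, map_add, hx, hy, map_add, smul_add]

end Action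

/-! ### Super-Hölder vectors of `M` and of `Ẽ ⊗ M` -/

section Levels

variable {p : ℕ} [Fact p.Prime] {k : ℕ} {hk : 1 ≤ k}

theorem rpow_level (k m i : ℕ) :
    (p : ℝ) ^ ((k : ℝ) - m) * (p : ℝ) ^ i = (p : ℝ) ^ (k + i) / (p : ℝ) ^ m := by
  have hp : (0 : ℝ) < p := by exact_mod_cast (Fact.out : p.Prime).pos
  rw [Real.rpow_sub hp, Real.rpow_natCast, Real.rpow_natCast, pow_add]
  ring

theorem shLevel_anti {N : Type*} [AddGroup N] {val : N → EReal} {act : Gam p k → N → N}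
    {lam lam' : ℝ} (h : lam' ≤ lam) : shLevel p k hk val act lam ⊆ shLevel p k hk val act lam' := by
  rintro x ⟨mu, hmu⟩
  refine ⟨mu, fun y z i hi => le_trans ?_ (hmu y z i hi)⟩
  have hp : (1 : ℝ) ≤ p := by exact_mod_cast (Fact.out : p.Prime).one_lt.le
  rw [EReal.coe_le_coe_iff]
  gcongr

variable {E : Type*} [Field E] [CharP E p]
  {M : Type*} [AddCommGroup M] [Module E⸨X⸩ M] [DistribMulAction (Gam p k) M]
  {hM : IsSemilinear p E k M} {ι : Type*} {b : Module.Basis ι E⸨X⸩ M}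

omit [CharP E p] in
theorem mem_modShLevel_iff {m : ℕ} {x : M} : x ∈ modShLevel p k hk b ((k : ℝ) - m) ↔
    ∃ mu : ℝ, ∀ (y z : ℤ_[p]) (i : ℕ), (p : ℤ_[p]) ^ i ∣ y - z →
      MGE b ((p : ℝ) ^ (k + i) / (p : ℝ) ^ m + mu)
        (coordInv p k hk y • x - coordInv p k hk z • x) := by
  simp_rw [modShLevel, shLevel, IsSuperHolder, le_basisVal_valE_iff, rpow_level, Set.mem_ofPred_eq]

theorem mem_tensorShLevel_iff {m : ℕ} {x : Etilde p E ⊗[E⸨X⸩] M} :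
    x ∈ tensorShLevel p k hk hM b ((k : ℝ) - m) ↔
    ∃ mu : ℝ, ∀ (y z : ℤ_[p]) (i : ℕ), (p : ℤ_[p]) ^ i ∣ y - z →
      TGE p b ((p : ℝ) ^ (k + i) / (p : ℝ) ^ m + mu)
        (tensorAct p k hM (coordInv p k hk y) x - tensorAct p k hM (coordInv p k hk z) x) := by
  simp_rw [tensorShLevel, shLevel, IsSuperHolder, le_basisVal_valEtilde_iff, rpow_level,
    Set.mem_ofPred_eq]

omit [CharP E p] in
theorem modShLevel_add {m : ℕ} {x x' : M} (h : x ∈ modShLevel p k hk b ((k : ℝ) - m))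
    (h' : x' ∈ modShLevel p k hk b ((k : ℝ) - m)) :
    x + x' ∈ modShLevel p k hk b ((k : ℝ) - m) := by
  rw [mem_modShLevel_iff] at *
  obtain ⟨mu, hmu⟩ := h
  obtain ⟨mu', hmu'⟩ := h'
  refine ⟨min mu mu', fun y z i hi => ?_⟩
  rw [smul_add, smul_add, add_sub_add_comm]
  exact ((hmu y z i hi).mono (by gcongr; exact min_le_left _ _)).add
    ((hmu' y z i hi).mono (by gcongr; exact min_le_right _ _))

theorem tensorShLevel_add {m : ℕ} {x x' : Etilde p E ⊗[E⸨X⸩] M}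
    (h : x ∈ tensorShLevel p k hk hM b ((k : ℝ) - m))
    (h' : x' ∈ tensorShLevel p k hk hM b ((k : ℝ) - m)) :
    x + x' ∈ tensorShLevel p k hk hM b ((k : ℝ) - m) := by
  rw [mem_tensorShLevel_iff] at *
  obtain ⟨mu, hmu⟩ := h
  obtain ⟨mu', hmu'⟩ := h'
  refine ⟨min mu mu', fun y z i hi => ?_⟩
  rw [map_add, map_add, add_sub_add_comm]
  exact ((hmu y z i hi).mono (by gcongr; exact min_le_left _ _)).add
    ((hmu' y z i hi).mono (by gcongr; exact min_le_right _ _))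

omit [CharP E p] in
/-- The orbit of a super-Hölder vector is bounded. -/
theorem exists_MGE_smul [Finite ι] {m : ℕ} {x : M} (h : x ∈ modShLevel p k hk b ((k : ℝ) - m)) :
    ∃ r, ∀ z, MGE b r (coordInv p k hk z • x) := by
  obtain ⟨mu, hmu⟩ := mem_modShLevel_iff.1 h
  obtain ⟨c, hc⟩ := exists_MGE b x
  refine ⟨min ((p : ℝ) ^ k / (p : ℝ) ^ m + mu) c, fun z => ?_⟩
  have h1 := hmu z 0 0 (by simp)
  rw [coordInv_zero, one_smul] at h1
  have := (h1.mono (min_le_left _ c)).add (hc.mono (min_le_right _ _))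
  simpa using this

theorem pow_div_pow_le {m₀ m : ℕ} (h : m₀ ≤ m) (s : ℕ) :
    (p : ℝ) ^ s / (p : ℝ) ^ m ≤ (p : ℝ) ^ s / (p : ℝ) ^ m₀ := by
  have hp : (1 : ℝ) ≤ p := by exact_mod_cast (Fact.out : p.Prime).one_lt.le
  gcongr

include hM in
/-- For levels at most `k`, the super-Hölder vectors of `M` form an `E((X))`-subspace. -/
theorem modShLevel_smul [Finite ι] {m : ℕ} {x : M} (f : E⸨X⸩)
    (h : x ∈ modShLevel p k hk b ((k : ℝ) - m)) : f • x ∈ modShLevel p k hk b ((k : ℝ) - m) := by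
  obtain ⟨c, hc⟩ := exists_MGE_smul h
  rw [mem_modShLevel_iff] at *
  obtain ⟨mu, hmu⟩ := h
  refine ⟨min (f.order + mu) (f.order - 1 + c), fun y z i hi => ?_⟩
  have h1 := MGE.smul ((LGE_order f).sigma p (coordInv p k hk y)) (hmu y z i hi)
  have h2 := MGE.smul ((LGE_order f).sigma_sub_sigma p (pow_dvd_coordInv_sub hk hi)) (hc z)
  have h3 := pow_div_pow_le (p := p) (Nat.zero_le m) (k + i)
  rw [pow_zero, div_one] at h3
  have h4 := min_le_left (f.order + mu) (f.order - 1 + c)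
  have h5 := min_le_right (f.order + mu) (f.order - 1 + c)
  convert (h1.mono (r := (p : ℝ) ^ (k + i) / (p : ℝ) ^ m + min (f.order + mu) (f.order - 1 + c))
    (by linarith)).add (h2.mono (by linarith)) using 1
  rw [hM, hM, smul_sub, sub_smul]
  abel

theorem tensorShLevel_tmul [Finite ι] {m₀ m : ℕ} (hm : m₀ ≤ m) {x : M}
    (h : x ∈ modShLevel p k hk b ((k : ℝ) - m₀)) (f : E⸨X⸩) :
    embTilde p E m f ⊗ₜ[E⸨X⸩] x ∈ tensorShLevel p k hk hM b ((k : ℝ) - m) := by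
  have hp : (0 : ℝ) < (p : ℝ) ^ m := pow_pos (by exact_mod_cast (Fact.out : p.Prime).pos) _
  obtain ⟨c, hc⟩ := exists_MGE_smul h
  obtain ⟨mu, hmu⟩ := mem_modShLevel_iff.1 h
  rw [mem_tensorShLevel_iff]
  have hemb : ∀ {r : ℝ} {g : E⸨X⸩}, LGE r g →
      HGE (r / (p : ℝ) ^ m) (embTilde p E m g : HahnSeries ℚ E) := fun {r g} hg =>
    (HGE_emb p).2 (hg.mono (div_mul_cancel₀ _ hp.ne').le)
  set d : ℝ := (f.order : ℝ) with hd
  refine ⟨min (d / (p : ℝ) ^ m + mu) ((d - 1) / (p : ℝ) ^ m + c), fun y z i hi => ?_⟩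
  have h1 := TGE.tmul (hemb ((LGE_order f).sigma p (coordInv p k hk y))) (hmu y z i hi)
  have h2 := TGE.tmul (hemb ((LGE_order f).sigma_sub_sigma p (pow_dvd_coordInv_sub hk hi))) (hc z)
  have h3 := pow_div_pow_le (p := p) hm (k + i)
  have h4 := min_le_left (d / (p : ℝ) ^ m + mu) ((d - 1) / (p : ℝ) ^ m + c)
  have h5 := min_le_right (d / (p : ℝ) ^ m + mu) ((d - 1) / (p : ℝ) ^ m + c)
  have h6 : (d + ((p : ℝ) ^ (k + i) - 1)) / (p : ℝ) ^ m
      = (p : ℝ) ^ (k + i) / (p : ℝ) ^ m + (d - 1) / (p : ℝ) ^ m := by ring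
  convert (h1.mono (r := (p : ℝ) ^ (k + i) / (p : ℝ) ^ m
    + min (d / (p : ℝ) ^ m + mu) ((d - 1) / (p : ℝ) ^ m + c)) (by linarith)).add
    (h2.mono (by linarith)) using 1
  have h7 : embTilde p E m (sigma p E (coordInv p k hk y) f - sigma p E (coordInv p k hk z) f)
      = embTilde p E m (sigma p E (coordInv p k hk y) f)
        - embTilde p E m (sigma p E (coordInv p k hk z) f) := Subtype.ext (map_sub _ _ _)
  rw [tensorAct_tmul, tensorAct_tmul, sigmaTilde_embTilde, sigmaTilde_embTilde, h7,
    TensorProduct.tmul_sub, TensorProduct.sub_tmul]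
  abel

theorem subTensor_subset [Finite ι] {m₀ m : ℕ} (hm : m₀ ≤ m)
    (h : modShLevel p k hk b ((k : ℝ) - m₀) = Set.univ) :
    (subTensor p M (Elevel p E m) : Set (Etilde p E ⊗[E⸨X⸩] M))
      ⊆ tensorShLevel p k hk hM b ((k : ℝ) - m) := by
  rintro _ ⟨t, rfl⟩
  induction t with
  | zero =>
    rw [map_zero]
    exact mem_tensorShLevel_iff.2 ⟨0, fun y z i _ => by simpa using TGE.zero _⟩
  | tmul v x =>
    obtain ⟨v, f, hf⟩ := v
    obtain rfl : embTilde p E m f = v := Subtype.ext hf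
    exact tensorShLevel_tmul hm (h ▸ Set.mem_univ x) f
  | add t t' h h' =>
    rw [map_add]
    exact tensorShLevel_add h h'

end Levels

/-! ### Super-Hölder vectors of `Ẽ ⊗ M` have few components -/

section Main

variable {p : ℕ} [Fact p.Prime] {k : ℕ} {hk : 1 ≤ k} {E : Type*} [Field E] [CharP E p]
  {M : Type*} [AddCommGroup M] [Module E⸨X⸩ M] [DistribMulAction (Gam p k) M]
  {hM : IsSemilinear p E k M} {ι : Type*} [Fintype ι] {b : Module.Basis ι E⸨X⸩ M}

/-- If `j` is prime to `p`, then `(1+X)^(j p^N) - 1` has valuation exactly `p^N`. -/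
theorem LGE_inv_onePlus_pow_sub_one {j : ℕ} (hj : ¬ p ∣ j) (N : ℕ) :
    onePlus E ^ (j * p ^ N) - 1 ≠ 0 ∧ LGE (-(p : ℝ) ^ N) (onePlus E ^ (j * p ^ N) - 1)⁻¹ := by
  have : ExpChar E⸨X⸩ p := by
    have : CharP E⸨X⸩ p := charP_of_injective_ringHom
      (f := (HahnSeries.C : E →+* E⸨X⸩)) HahnSeries.C_injective p
    exact ExpChar.prime Fact.out
  have h1 : (onePlus E ^ j - 1).coeff 1 ≠ 0 := by
    have e1 : onePlus E ^ j = HahnSeries.ofPowerSeries ℤ E (onePlusXPow p E j) := by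
      have := onePlusXPow_natCast_mul p E j 1
      rw [mul_one] at this
      rw [this, onePlusXPow_one, map_pow, onePlus]
    rw [HahnSeries.coeff_sub, e1, PowerSeries.coeff_coe, if_neg (by norm_num), HahnSeries.coeff_one,
      if_neg (by norm_num), sub_zero]
    simp only [onePlusXPow, PowerSeries.coeff_mk]
    rw [Int.natAbs_one, Ring.choose_one_right, map_natCast, Ne, CharP.cast_eq_zero_iff E p]
    exact hj
  have h2 : onePlus E ^ (j * p ^ N) - 1 = (onePlus E ^ j - 1) ^ p ^ N := by
    rw [pow_mul, sub_pow_expChar_pow, one_pow]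
  constructor
  · rw [h2]
    refine pow_ne_zero _ fun h0 => h1 ?_
    rw [h0, HahnSeries.coeff_zero]
  · rw [h2, ← inv_pow]
    refine ((LGE.inv h1).pow (p ^ N)).mono ?_
    push_cast
    linarith

/-- Let `u = (1+X)^(j/p^n)`. As `γ = 1 + p^s` maps `u` to `a u` with `a = (1+X)^(j p^(s-n))`, the
action of `γ` on the component of `x` along `u⁻¹` is twisted by `a`. -/
theorem sub_one_smul_tateM {n s : ℕ} (hns : n ≤ s) (hs : s ≠ 0) {g : Gam p k}
    (hg : ((g : ℤ_[p]ˣ) : ℤ_[p]) = 1 + (p : ℤ_[p]) ^ s) (j : ℕ) (x : Etilde p E ⊗[E⸨X⸩] M) :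
    (onePlus E ^ (j * p ^ (s - n)) - 1) • tateM p M (embTilde p E n (onePlus E ^ j) • x)
      = g • tateM p M (embTilde p E n (onePlus E ^ j) • x)
          - tateM p M (embTilde p E n (onePlus E ^ j) • x)
        - onePlus E ^ (j * p ^ (s - n)) •
          tateM p M (embTilde p E n (onePlus E ^ j) • (tensorAct p k hM g x - x)) := by
  set a : E⸨X⸩ := onePlus E ^ (j * p ^ (s - n)) with ha
  have h1 : sigmaTilde p E g (embTilde p E n (onePlus E ^ j))
      = algebraMap E⸨X⸩ (Etilde p E) a * embTilde p E n (onePlus E ^ j) := by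
    have e1 := embTilde_phi_iterate (p := p) (E := E) 0 n a
    rw [zero_add, phi_iterate_onePlus_pow] at e1
    rw [← embTilde_zero, ← e1, sigmaTilde_embTilde, map_pow, sigma_onePlus_of_eq p hg, mul_pow,
      mul_comm, ← pow_mul, embTilde_mul, mul_left_comm (p ^ n), ← pow_add, Nat.add_sub_cancel' hns,
      mul_comm j]
  have h2 : g • tateM p M (embTilde p E n (onePlus E ^ j) • x)
      = a • tateM p M (embTilde p E n (onePlus E ^ j) • tensorAct p k hM g x) := by
    rw [← tateM_tensorAct hM hs hg, tensorAct_smul, h1, mul_smul, algebraMap_smul, map_smul]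
  rw [smul_sub, map_sub, smul_sub, ← h2, sub_smul, one_smul]
  abel

omit [Fintype ι] in
/-- A super-Hölder vector of level `k - m` has no component along `(1+X)^i` if the denominator of
`i` does not divide `p^m`. On such a component, the elements `1 + p^s` of `Γ_k` act trivially only
up to an error of valuation about `p^(s-m-1)`, which is too small for large `s`. -/
theorem tateM_eq_zero {m₀ m : ℕ} (hm : m₀ ≤ m)
    (h : modShLevel p k hk b ((k : ℝ) - m₀) = Set.univ) {x : Etilde p E ⊗[E⸨X⸩] M}
    (hx : x ∈ tensorShLevel p k hk hM b ((k : ℝ) - m)) {n j : ℕ} (hmn : m ≤ n)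
    (hj : ¬ p ^ (n - m) ∣ j) : tateM p M (embTilde p E n (onePlus E ^ j) • x) = 0 := by
  have hp := (Fact.out : p.Prime)
  have hp0 : (0 : ℝ) < p := by exact_mod_cast hp.pos
  have hj0 : j ≠ 0 := by
    rintro rfl
    exact hj (dvd_zero _)
  obtain ⟨v, j', hj', rfl⟩ := Nat.exists_eq_pow_mul_and_not_dvd hj0 p hp.ne_one
  have hv : v < n - m := by
    by_contra! hv
    exact hj (Dvd.dvd.mul_right (pow_dvd_pow p hv) j')
  set u := embTilde p E n (onePlus E ^ (p ^ v * j')) with hu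
  set w := tateM p M (u • x) with hw
  obtain ⟨mu₁, hmu₁⟩ := mem_modShLevel_iff.1 (h ▸ Set.mem_univ w)
  obtain ⟨mu₂, hmu₂⟩ := mem_tensorShLevel_iff.1 hx
  set C := min mu₁ (mu₂ - 1) with hC
  have hC1 : C ≤ mu₁ := min_le_left _ _
  have hC2 : C ≤ mu₂ - 1 := min_le_right _ _
  have hmain : ∀ i : ℕ, MGE b (i + C) w := by
    intro i
    -- the element `γ = 1 + p^s` with `s = k + (n + i)`
    set g := coordInv p k hk ((p : ℤ_[p]) ^ (n + i)) with hg
    have h1 := hmu₁ ((p : ℤ_[p]) ^ (n + i)) 0 (n + i) (by simp)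
    have h2 := hmu₂ ((p : ℤ_[p]) ^ (n + i)) 0 (n + i) (by simp)
    rw [coordInv_zero, one_smul, ← hg] at h1
    rw [coordInv_zero, tensorAct_one, ← hg] at h2
    have hu0 : HGE 0 (u : HahnSeries ℚ E) := by
      rw [hu]
      refine (HGE_emb p).2 ?_
      rw [zero_mul]
      exact (LGE_onePlus_pow _).1
    have h3 := sub_one_smul_tateM (hM := hM) (n := n) (s := k + (n + i)) (by omega) (by omega)
      (coordInv_pow_val hk (n + i)) (p ^ v * j') x
    rw [← hg, ← hu, ← hw] at h3
    have e1 : p ^ v * j' * p ^ (k + (n + i) - n) = j' * p ^ (v + (k + i)) := by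
      rw [show k + (n + i) - n = k + i by omega, pow_add p v]
      ring
    rw [e1] at h3
    obtain ⟨hne, hinv⟩ := LGE_inv_onePlus_pow_sub_one (E := E) hj' (v + (k + i))
    have h4 := (h1.mono (r := (p : ℝ) ^ (k + (n + i)) / (p : ℝ) ^ m + C) (by
      have := pow_div_pow_le (p := p) hm (k + (n + i))
      linarith)).sub ((MGE.smul (LGE_onePlus_pow (E := E) (j' * p ^ (v + (k + i)))).1
        (TGE.tateM (TGE.smul hu0 h2))).mono
          (r := (p : ℝ) ^ (k + (n + i)) / (p : ℝ) ^ m + C) (by linarith))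
    rw [← h3] at h4
    have h5 := MGE.smul hinv h4
    rw [smul_smul, inv_mul_cancel₀ hne, one_smul] at h5
    refine h5.mono ?_
    -- `p^(s-m)` is at least twice `p^(s-n+v)`
    have h6 : (p : ℝ) ^ (k + (n + i)) / (p : ℝ) ^ m
        = (p : ℝ) ^ (v + (k + i)) * (p : ℝ) ^ (n - m - v) := by
      rw [div_eq_iff (by positivity), ← pow_add, ← pow_add]
      congr 1
      omega
    have h7 : (2 : ℝ) ≤ (p : ℝ) ^ (n - m - v) := by
      have h71 : (2 : ℝ) ≤ p := by exact_mod_cast hp.two_le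
      exact h71.trans (le_self_pow₀ (by linarith) (by omega))
    have h8 : (i : ℝ) ≤ (p : ℝ) ^ (v + (k + i)) := by
      have h81 : i < p ^ (v + (k + i)) :=
        lt_of_le_of_lt (by omega : i ≤ v + (k + i)) (Nat.lt_pow_self hp.one_lt)
      exact_mod_cast h81.le
    rw [h6]
    nlinarith [pow_pos hp0 (v + (k + i))]
  refine eq_zero_of_MGE (b := b) fun r => ?_
  obtain ⟨i, hi⟩ := exists_nat_ge (r - C)
  exact (hmain i).mono (by linarith)

/-- The super-Hölder vectors of `Ẽ ⊗ M`, when all the vectors of `M` are super-Hölder of level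
`k - m₀`. -/
theorem tensorShLevel_eq {m₀ m : ℕ} (hm : m₀ ≤ m)
    (h : modShLevel p k hk b ((k : ℝ) - m₀) = Set.univ) :
    tensorShLevel p k hk hM b ((k : ℝ) - m) = subTensor p M (Elevel p E m) := by
  refine Set.Subset.antisymm (fun x hx => (mem_subTensor_iff b).2 fun i => ?_)
    (subTensor_subset hm h)
  refine mem_Elevel_of_tate_eq_zero fun n j hmn hj => ?_
  have h1 := repr_tateM (b := b) (embTilde p E n (onePlus E ^ j) • x) i
  rw [tateM_eq_zero hm h hx hmn hj, map_smul, Finsupp.smul_apply, smul_eq_mul] at h1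
  simpa using h1.symm

omit [CharP E p] in
theorem Elevel_mono {m n : ℕ} (h : m ≤ n) : Elevel p E m ≤ Elevel p E n := by
  rintro x ⟨y, hy⟩
  refine ⟨(phi p E)^[n - m] y, ?_⟩
  rw [← hy, ← emb_phi_iterate p E m (n - m), Nat.add_sub_cancel' h]

theorem tensorSh_eq {m₀ : ℕ} (h : modShLevel p k hk b ((k : ℝ) - m₀) = Set.univ) :
    tensorSh p k hk hM b = subTensor p M (Einfty p E) := by
  ext x
  constructor
  · rintro ⟨lam, hlam⟩
    obtain ⟨m, hm⟩ := exists_nat_ge (max (m₀ : ℝ) (k - lam))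
    have h1 : m₀ ≤ m := by exact_mod_cast (le_max_left _ _).trans hm
    have h2 : (k : ℝ) - m ≤ lam := by linarith [(le_max_right (m₀ : ℝ) (k - lam)).trans hm]
    have h3 : x ∈ tensorShLevel p k hk hM b ((k : ℝ) - m) := shLevel_anti h2 hlam
    rw [tensorShLevel_eq h1 h] at h3
    exact (mem_subTensor_iff b).2 fun i => ⟨m, (mem_subTensor_iff b).1 h3 i⟩
  · intro hx
    choose m hm using (mem_subTensor_iff b).1 hx
    have h1 : x ∈ tensorShLevel p k hk hM b
        ((k : ℝ) - (m₀ ⊔ Finset.univ.sup m : ℕ)) := by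
      rw [tensorShLevel_eq le_sup_left h]
      exact (mem_subTensor_iff b).2 fun i => Elevel_mono
        ((Finset.le_sup (Finset.mem_univ i)).trans le_sup_right) (hm i)
    exact ⟨_, h1⟩

include hM in
theorem modShLevel_eq_univ_of_basis {m : ℕ} (h : ∀ i, b i ∈ modShLevel p k hk b ((k : ℝ) - m)) :
    modShLevel p k hk b ((k : ℝ) - m) = Set.univ := by
  refine Set.eq_univ_of_forall fun x => ?_
  rw [← b.sum_repr x]
  refine Finset.sum_induction _ (· ∈ modShLevel p k hk b ((k : ℝ) - m))
    (fun _ _ => modShLevel_add) ?_ fun i _ => modShLevel_smul (hM := hM) _ (h i)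
  exact mem_modShLevel_iff.2 ⟨0, fun y z i _ => by simpa using MGE.zero _⟩

include hM in
theorem exists_modShLevel_eq_univ (h : modSh p k hk b = Set.univ) :
    ∃ m₀ : ℕ, modShLevel p k hk b ((k : ℝ) - m₀) = Set.univ := by
  have h1 : ∀ i, ∃ m : ℕ, b i ∈ modShLevel p k hk b ((k : ℝ) - m) := by
    intro i
    obtain ⟨lam, hlam⟩ : b i ∈ modSh p k hk b := h ▸ Set.mem_univ _
    obtain ⟨m, hm⟩ := exists_nat_ge (k - lam)
    exact ⟨m, shLevel_anti (by linarith) hlam⟩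
  choose m hm using h1
  refine ⟨Finset.univ.sup m, modShLevel_eq_univ_of_basis (hM := hM) fun i =>
    shLevel_anti ?_ (hm i)⟩
  have : (m i : ℝ) ≤ (Finset.univ.sup m : ℕ) := by exact_mod_cast Finset.le_sup (Finset.mem_univ i)
  linarith

end Main

/-! ### Consequences of the continuity of the action -/

section Continuity

variable {p : ℕ} [Fact p.Prime] {k : ℕ} (hk : 1 ≤ k) {E : Type*} [Field E]
  {M : Type*} [AddCommGroup M] [Module E⸨X⸩ M] {ι : Type*} (b : Module.Basis ι E⸨X⸩ M)

theorem isOpen_LGE (r : ℝ) : IsOpen {f : E⸨X⸩ | LGE r f} := by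
  have h0 : {f : E⸨X⸩ | LGE r f}
      = (fun f => HahnSeries.single (-⌈r⌉) 1 * f) ⁻¹' (Valued.integer E⸨X⸩ : Set E⸨X⸩) := by
    ext f
    have h1 : HahnSeries.single (-⌈r⌉) 1 * f ∈ (Valued.integer E⸨X⸩ : Set E⸨X⸩) ↔
        LGE 0 (HahnSeries.single (-⌈r⌉) 1 * f) :=
      (LaurentSeries.val_le_one_iff_eq_coe E _).trans LGE_zero_iff.symm
    rw [Set.mem_preimage, h1]
    constructor
    · intro h
      have h2 : LGE (⌈r⌉ : ℝ) f := LGE_intCast.2 (LGE_iff_ceil.1 h)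
      exact ((LGE_single (-⌈r⌉) 1).mul h2).mono (by simp)
    · intro h
      have h2 := (LGE_single ⌈r⌉ (1 : E)).mul h
      rw [← mul_assoc, HahnSeries.single_mul_single, add_neg_cancel, mul_one] at h2
      rw [HahnSeries.single_zero_one, one_mul] at h2
      exact h2.mono (by simpa using Int.le_ceil r)
  rw [h0]
  exact (Valued.isOpen_integer E⸨X⸩).preimage (continuous_const_mul _)

theorem continuous_coordInv : Continuous (coordInv p k hk) := by
  refine Continuous.subtype_mk ?_ _
  rw [Units.isOpenEmbedding_val.isEmbedding.isInducing.continuous_iff]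
  exact continuous_const.add (continuous_const.mul continuous_id)

theorem exists_pow_dvd_imp {U : Set ℤ_[p]} (hU : IsOpen U) (h0 : 0 ∈ U) :
    ∃ n : ℕ, ∀ z : ℤ_[p], (p : ℤ_[p]) ^ n ∣ z → z ∈ U := by
  obtain ⟨ε, hε, hball⟩ := Metric.isOpen_iff.1 hU 0 h0
  obtain ⟨n, hn⟩ := PadicInt.exists_pow_neg_lt p hε
  refine ⟨n, fun z hz => hball ?_⟩
  rw [mem_ball_zero_iff]
  exact lt_of_le_of_lt ((PadicInt.norm_le_pow_iff_mem_span_pow z n).2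
    (Ideal.mem_span_singleton.2 hz)) hn

variable [TopologicalSpace M] [IsModuleTopology E⸨X⸩ M]

theorem isOpen_MGE [Finite ι] (r : ℝ) (m₀ : M) : IsOpen {m : M | MGE b r (m - m₀)} := by
  have h : {m : M | MGE b r (m - m₀)}
      = ⋂ i, (fun m => b.coord i m - b.coord i m₀) ⁻¹' {f | LGE r f} := by
    ext m
    simp [MGE]
  rw [h]
  refine isOpen_iInter_of_finite fun i => (isOpen_LGE r).preimage ?_
  exact (IsModuleTopology.continuous_of_linearMap (b.coord i)).sub continuous_const

variable [DistribMulAction (Gam p k) M] [ContinuousSMul (Gam p k) M]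

theorem exists_forall_MGE_smul_sub [Finite ι] (r : ℝ) (m : M) : ∃ n : ℕ, ∀ z : ℤ_[p],
    (p : ℤ_[p]) ^ n ∣ z → MGE b r (coordInv p k hk z • m - m) := by
  have h1 : Continuous fun z : ℤ_[p] => coordInv p k hk z • m :=
    (continuous_coordInv hk).smul continuous_const
  refine exists_pow_dvd_imp ((isOpen_MGE b r m).preimage h1) ?_
  change MGE b r (coordInv p k hk 0 • m - m)
  rw [coordInv_zero, one_smul, sub_self]
  exact MGE.zero r

include hk in
/-- As `Γ_k` is compact, its orbits on `M` are bounded. -/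
theorem exists_forall_MGE_smul [Finite ι] (m : M) : ∃ r, ∀ g : Gam p k, MGE b r (g • m) := by
  have h1 : Continuous fun z : ℤ_[p] => coordInv p k hk z • m :=
    (continuous_coordInv hk).smul continuous_const
  obtain ⟨N, hN⟩ := (isCompact_univ (X := ℤ_[p])).elim_directed_cover
    (fun n : ℕ => (fun z : ℤ_[p] => coordInv p k hk z • m) ⁻¹' {m | MGE b (-(n : ℝ)) (m - 0)})
    (fun n => (isOpen_MGE b _ 0).preimage h1)
    (fun z _ => by
      obtain ⟨r, hr⟩ := exists_MGE b (coordInv p k hk z • m)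
      obtain ⟨n, hn⟩ := exists_nat_ge (-r)
      refine Set.mem_iUnion.2 ⟨n, ?_⟩
      change MGE b (-(n : ℝ)) (coordInv p k hk z • m - 0)
      rw [sub_zero]
      exact hr.mono (by linarith))
    (Monotone.directed_le fun n n' hn z hz => by
      have hn' : (n : ℝ) ≤ n' := by exact_mod_cast hn
      exact MGE.mono hz (by linarith))
  refine ⟨-(N : ℝ), fun g => ?_⟩
  obtain ⟨z, rfl⟩ := coordInv_surjective hk g
  have h2 : MGE b (-(N : ℝ)) (coordInv p k hk z • m - 0) := hN (Set.mem_univ z)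
  rwa [sub_zero] at h2

end Continuity

/-! ### Existence of a good basis -/

section GoodBasis

variable {p : ℕ} [Fact p.Prime] {k : ℕ} (hk : 1 ≤ k) {E : Type*} [Field E] [CharP E p]
  {M : Type*} [AddCommGroup M] [Module E⸨X⸩ M] [Module.Finite E⸨X⸩ M]
  [TopologicalSpace M] [IsModuleTopology E⸨X⸩ M]
  [DistribMulAction (Gam p k) M] [ContinuousSMul (Gam p k) M]

include hk in
/-- The lattice generated by the orbits of the vectors of a basis is stable. It is finitely
generated since these orbits are bounded, hence it is free, and its bases are good. -/
theorem exists_isGood (hM : IsSemilinear p E k M) :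
    ∃ b : Module.Basis (Fin (Module.finrank E⸨X⸩ M)) E⸨X⸩ M, IsGood p k b := by
  let b₀ := Module.finBasis E⸨X⸩ M
  let _ : Module (PowerSeries E) M := Module.compHom M (algebraMap (PowerSeries E) E⸨X⸩)
  have : IsScalarTower (PowerSeries E) E⸨X⸩ M := ⟨fun a f m => by
    rw [Algebra.smul_def, mul_smul]
    rfl⟩
  have hsmul : ∀ (a : PowerSeries E) (m : M), a • m = HahnSeries.ofPowerSeries ℤ E a • m :=
    fun a m => rfl
  let L : Submodule (PowerSeries E) M :=
    Submodule.span _ (Set.range fun gi : Gam p k × Fin (Module.finrank E⸨X⸩ M) => gi.1 • b₀ gi.2)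
  have hstable : ∀ (g : Gam p k), ∀ m ∈ L, g • m ∈ L := by
    intro g m hm
    induction hm using Submodule.span_induction with
    | mem x hx =>
      obtain ⟨⟨g', i⟩, rfl⟩ := hx
      exact Submodule.subset_span ⟨(g * g', i), mul_smul _ _ _⟩
    | zero => rw [smul_zero]; exact L.zero_mem
    | add x y _ _ hx hy => rw [smul_add]; exact L.add_mem hx hy
    | smul a x _ hx =>
      rw [hsmul, hM, sigma_coe, ← hsmul]
      exact L.smul_mem _ hx
  choose r hr using fun i => exists_forall_MGE_smul (p := p) (k := k) hk b₀ (b₀ i)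
  obtain ⟨N, hN⟩ : ∃ N : ℕ, ∀ i, -(N : ℝ) ≤ r i := by
    obtain ⟨c, hc⟩ := (Set.finite_range r).bddBelow
    obtain ⟨N, hN⟩ := exists_nat_ge (-c)
    exact ⟨N, fun i => by linarith [hc ⟨i, rfl⟩]⟩
  let L' : Submodule (PowerSeries E) M :=
    Submodule.span _ (Set.range fun i => HahnSeries.single (-(N : ℤ)) (1 : E) • b₀ i)
  have hLL' : L ≤ L' := by
    refine Submodule.span_le.2 ?_
    rintro _ ⟨⟨g, i⟩, rfl⟩
    change g • b₀ i ∈ L'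
    rw [← b₀.sum_repr (g • b₀ i)]
    refine L'.sum_mem fun j _ => ?_
    obtain ⟨a, ha⟩ := exists_eq_single_mul (d := -(N : ℤ)) (b₀.repr (g • b₀ i) j)
      ((hr i g j).mono (by push_cast; exact hN i))
    rw [ha, mul_comm, mul_smul, ← hsmul]
    exact L'.smul_mem _ (Submodule.subset_span ⟨j, rfl⟩)
  have hL'fg : L'.FG := Submodule.fg_span (Set.finite_range _)
  have : IsNoetherian (PowerSeries E) L' := isNoetherian_of_fg_of_noetherian _ hL'fg
  have hLfg : L.FG := by
    have h1 : (L.comap L'.subtype).FG := IsNoetherian.noetherian _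
    have h2 := h1.map L'.subtype
    rwa [Submodule.map_comap_subtype, inf_eq_right.2 hLL'] at h2
  have : Submodule.IsLattice E⸨X⸩ L := ⟨hLfg, by
    rw [eq_top_iff, ← b₀.span_eq]
    refine Submodule.span_mono ?_
    rintro _ ⟨i, rfl⟩
    exact Submodule.subset_span ⟨(1, i), one_smul _ _⟩⟩
  have : Module.Free (PowerSeries E) L := Submodule.IsLattice.free E⸨X⸩ L
  let c := Module.Free.chooseBasis (PowerSeries E) L
  let b₁ := c.extendOfIsLattice E⸨X⸩
  let e : Module.Free.ChooseBasisIndex (PowerSeries E) L ≃ Fin (Module.finrank E⸨X⸩ M) :=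
    Fintype.equivFinOfCardEq (Module.finrank_eq_card_basis b₁).symm
  have hb₁ : ∀ j, b₁ j = (c j : M) := fun j => Module.Basis.extendOfIsLattice_apply _ _ _
  refine ⟨b₁.reindex e, ?_⟩
  intro g m hm i
  have hmL : m ∈ L := by
    rw [← (b₁.reindex e).sum_repr m]
    refine L.sum_mem fun j _ => ?_
    obtain ⟨a, ha⟩ := hm j
    rw [← ha, ← hsmul, Module.Basis.reindex_apply, hb₁]
    exact L.smul_mem _ (c _).2
  have hgm := hstable g m hmL
  have h1 : g • m = ∑ j, HahnSeries.ofPowerSeries ℤ E (c.repr ⟨g • m, hgm⟩ j) • b₁ j := by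
    have h2 := congrArg (Subtype.val) (c.sum_repr ⟨g • m, hgm⟩)
    rw [Submodule.coe_sum] at h2
    refine h2.symm.trans ?_
    refine Finset.sum_congr rfl fun j _ => ?_
    rw [hb₁, ← hsmul]
    rfl
  rw [h1, Module.Basis.repr_reindex_apply, Module.Basis.repr_sum_self]
  exact ⟨_, rfl⟩

end GoodBasis

/-! ### The case of `(φ,Γ)`-modules -/

section PhiGamma

variable {p : ℕ} [Fact p.Prime] {k : ℕ} (hk : 1 ≤ k) {E : Type*} [Field E] [CharP E p]
  {M : Type*} [AddCommGroup M] [Module E⸨X⸩ M] [DistribMulAction (Gam p k) M]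
  {ι : Type*} [Fintype ι] {b : Module.Basis ι E⸨X⸩ M}

/-- The group `Γ_k` preserves the valuation attached to a good basis. -/
theorem IsGood.MGE_smul (hM : IsSemilinear p E k M) (hb : IsGood p k b) (g : Gam p k) {r : ℝ}
    {m : M} (hm : MGE b r m) : MGE b r (g • m) := by
  rw [← b.sum_repr m, Finset.smul_sum]
  refine MGE.sum fun i _ => ?_
  rw [hM]
  have h1 : MGE b 0 (g • b i) := fun j =>
    LGE_zero_iff.2 (hb g (b i) (fun j => LGE_zero_iff.1 (MGE.basis i j)) j)
  exact (MGE.smul ((hm i).sigma p g) h1).mono (add_zero r).ge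

/-- The contraction argument: if `γ ∈ 1 + p^s ℤ_p` moves the basis `b` little enough, then it moves
it by at most `p^s - A`, because conjugating the matrix of `γ` by that of `φ` multiplies by `p` the
valuation of its difference with the identity. -/
theorem exists_MGE_smul_sub_of_phi (hM : IsSemilinear p E k M) {phiM : M →+ M}
    (hsemi : ∀ (f : E⸨X⸩) (m : M), phiM (f • m) = phi p E f • phiM m)
    (hcomm : ∀ (g : Gam p k) (m : M), phiM (g • m) = g • phiM m)
    {Q : ι → ι → E⸨X⸩} (hQ : ∀ i, b i = ∑ j, Q j i • phiM (b j)) :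
    ∃ A : ℝ, ∀ (g : Gam p k) (s : ℕ), (p : ℤ_[p]) ^ s ∣ ((g : ℤ_[p]ˣ) : ℤ_[p]) - 1 →
      (∀ i, MGE b (A + 1) (g • b i - b i)) → ∀ i, MGE b ((p : ℝ) ^ s - A) (g • b i - b i) := by
  have hp2 : (2 : ℝ) ≤ p := by exact_mod_cast (Fact.out : p.Prime).two_le
  obtain ⟨a, ha0, ha⟩ : ∃ a : ℝ, 0 ≤ a ∧ ∀ j, MGE b (-a) (phiM (b j)) := by
    choose r hr using fun j => exists_MGE b (phiM (b j))
    obtain ⟨c, hc⟩ := (Set.finite_range r).bddBelow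
    refine ⟨max 0 (-c), le_max_left _ _, fun j => (hr j).mono ?_⟩
    linarith [hc ⟨j, rfl⟩, le_max_right 0 (-c)]
  obtain ⟨q, hq0, hq⟩ : ∃ q : ℝ, 0 ≤ q ∧ ∀ j i, LGE (-q) (Q j i) := by
    obtain ⟨c, hc⟩ :=
      (Set.finite_range fun ji : ι × ι => (((Q ji.1 ji.2).order : ℤ) : ℝ)).bddBelow
    refine ⟨max 0 (-c), le_max_left _ _, fun j i => (LGE_order _).mono ?_⟩
    have h1 : c ≤ (((Q j i).order : ℤ) : ℝ) := hc ⟨(j, i), rfl⟩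
    linarith [le_max_right 0 (-c)]
  have hphi : ∀ {c : ℝ} {m : M}, MGE b c m → MGE b (p * c - a) (phiM m) := by
    intro c m hm
    rw [← b.sum_repr m, map_sum]
    refine MGE.sum fun i _ => ?_
    rw [hsemi]
    exact MGE.smul ((hm i).phi p) (ha i)
  refine ⟨a + q + 1, fun g s hgs hg => ?_⟩
  set A := a + q + 1 with hA
  have hstep : ∀ c : ℝ, (∀ i, MGE b c (g • b i - b i)) →
      ∀ i, MGE b (min (p * c - A) ((p : ℝ) ^ s - A)) (g • b i - b i) := by
    intro c hc i
    have h1 : g • b i - b i = ∑ j, (sigma p E g (Q j i) • phiM (g • b j - b j)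
        + (sigma p E g (Q j i) - Q j i) • phiM (b j)) := by
      conv_lhs => rw [hQ i, Finset.smul_sum, ← Finset.sum_sub_distrib]
      refine Finset.sum_congr rfl fun j _ => ?_
      rw [hM, map_sub, hcomm, smul_sub, sub_smul]
      abel
    rw [h1]
    refine MGE.sum fun j _ => MGE.add ?_ ?_
    · exact (MGE.smul ((hq j i).sigma p g) (hphi (hc j))).mono
        ((min_le_left _ _).trans (by linarith))
    · have h2 := LGE.sigma_sub_sigma p (a := g) (b := 1) (by simpa using hgs) (hq j i)
      rw [sigma_one] at h2
      exact (MGE.smul h2 (ha j)).mono ((min_le_right _ _).trans (by linarith))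
  have hiter : ∀ (N : ℕ) (i : ι),
      MGE b (min (A + 1 + N) ((p : ℝ) ^ s - A)) (g • b i - b i) := by
    intro N
    induction N with
    | zero => exact fun i => (hg i).mono ((min_le_left _ _).trans (by simp))
    | succ N ih =>
      intro i
      rcases le_total (A + 1 + N : ℝ) ((p : ℝ) ^ s - A) with h | h
      · rw [min_eq_left h] at ih
        refine (hstep _ ih i).mono (min_le_min_right _ ?_)
        push_cast
        have hN : (0 : ℝ) ≤ N := Nat.cast_nonneg N
        nlinarith
      · rw [min_eq_right h] at ih
        exact (ih i).mono (min_le_right _ _)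
  intro i
  obtain ⟨N, hN⟩ := exists_nat_ge ((p : ℝ) ^ s - A - (A + 1))
  have := hiter N i
  rwa [min_eq_right (by linarith)] at this

variable [TopologicalSpace M] [IsModuleTopology E⸨X⸩ M] [ContinuousSMul (Gam p k) M]

/-- A `(φ,Γ)`-module is super-Hölder of level `k`. -/
theorem modShLevel_eq_univ_of_phi (hM : IsSemilinear p E k M) (hb : IsGood p k b) {phiM : M →+ M}
    (hsemi : ∀ (f : E⸨X⸩) (m : M), phiM (f • m) = phi p E f • phiM m)
    (hcomm : ∀ (g : Gam p k) (m : M), phiM (g • m) = g • phiM m)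
    {Q : ι → ι → E⸨X⸩} (hQ : ∀ i, b i = ∑ j, Q j i • phiM (b j)) :
    modShLevel p k hk b ((k : ℝ) - (0 : ℕ)) = Set.univ := by
  have hp1 : (1 : ℝ) ≤ p := by exact_mod_cast (Fact.out : p.Prime).one_lt.le
  obtain ⟨A, hA⟩ := exists_MGE_smul_sub_of_phi hM hsemi hcomm hQ
  choose n hn using fun i => exists_forall_MGE_smul_sub (p := p) hk b (A + 1) (b i)
  set n₀ := k + Finset.univ.sup n with hn₀
  set C := max A ((p : ℝ) ^ n₀) with hC
  have hmain : ∀ (g : Gam p k) (s : ℕ), (p : ℤ_[p]) ^ s ∣ ((g : ℤ_[p]ˣ) : ℤ_[p]) - 1 →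
      ∀ i, MGE b ((p : ℝ) ^ s - C) (g • b i - b i) := by
    intro g s hgs i
    rcases le_total n₀ s with h | h
    · refine (hA g s hgs (fun i => ?_) i).mono (by linarith [le_max_left A ((p : ℝ) ^ n₀)])
      obtain ⟨z, rfl⟩ := coordInv_surjective hk g
      refine hn i z ?_
      rw [coordInv_val, add_sub_cancel_left] at hgs
      have h1 := (pow_dvd_pow (p : ℤ_[p]) h).trans hgs
      rw [hn₀, pow_add] at h1
      have hp0 : (p : ℤ_[p]) ^ k ≠ 0 :=
        pow_ne_zero _ (by exact_mod_cast (Fact.out : p.Prime).ne_zero)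
      exact (pow_dvd_pow _ (Finset.le_sup (Finset.mem_univ i))).trans
        ((mul_dvd_mul_iff_left hp0).1 h1)
    · have h1 : (p : ℝ) ^ s ≤ (p : ℝ) ^ n₀ := pow_le_pow_right₀ hp1 h
      exact ((hb.MGE_smul hM g (MGE.basis i)).sub (MGE.basis i)).mono
        (by linarith [le_max_right A ((p : ℝ) ^ n₀)])
  refine modShLevel_eq_univ_of_basis (hM := hM) fun j => mem_modShLevel_iff.2 ⟨-C, ?_⟩
  intro y z i hi
  set gy := coordInv p k hk y
  set gz := coordInv p k hk z
  have h1 : gy • b j - gz • b j = gz • ((gz⁻¹ * gy) • b j - b j) := by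
    rw [smul_sub, smul_smul, mul_inv_cancel_left]
  have h2 : (p : ℤ_[p]) ^ (k + i) ∣ (((gz⁻¹ * gy : Gam p k) : ℤ_[p]ˣ) : ℤ_[p]) - 1 := by
    have h3 : (((gz⁻¹ * gy : Gam p k) : ℤ_[p]ˣ) : ℤ_[p]) - 1
        = (((gz⁻¹ : Gam p k) : ℤ_[p]ˣ) : ℤ_[p])
          * (((gy : ℤ_[p]ˣ) : ℤ_[p]) - ((gz : ℤ_[p]ˣ) : ℤ_[p])) := by
      rw [mul_sub]
      simp
    rw [h3]
    exact Dvd.dvd.mul_left (pow_dvd_coordInv_sub hk hi) _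
  rw [h1, pow_zero, div_one]
  exact hb.MGE_smul hM gz (hmain _ _ h2 j)

omit [CharP E p] [Fact p.Prime] [DistribMulAction (Gam p k) M] [TopologicalSpace M]
  [IsModuleTopology E⸨X⸩ M] [ContinuousSMul (Gam p k) M] in
theorem exists_eq_sum_smul_of_isUnit_toMatrix [DecidableEq ι] {v : ι → M}
    (h : IsUnit (b.toMatrix v)) : ∃ Q : ι → ι → E⸨X⸩, ∀ i, b i = ∑ j, Q j i • v j := by
  obtain ⟨u, hu⟩ := h
  refine ⟨fun j i => (↑u⁻¹ : Matrix ι ι E⸨X⸩) j i, fun i => ?_⟩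
  have h1 : ∀ j, v j = ∑ l, (u : Matrix ι ι E⸨X⸩) l j • b l := fun j => by
    rw [hu, b.sum_toMatrix_smul_self]
  have h2 : ∀ l, ∑ j, (↑u⁻¹ : Matrix ι ι E⸨X⸩) j i * (u : Matrix ι ι E⸨X⸩) l j
      = if l = i then 1 else 0 := fun l => by
    have := congrFun (congrFun u.mul_inv l) i
    rw [Matrix.mul_apply, Matrix.one_apply] at this
    rw [← this]
    exact Finset.sum_congr rfl fun j _ => mul_comm _ _
  simp_rw [h1, Finset.smul_sum, smul_smul]
  rw [Finset.sum_comm]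
  simp_rw [← Finset.sum_smul, h2]
  simp

end PhiGamma

end SuperHolder

end

theorem mainTheorem5 (p : ℕ) [Fact p.Prime] (E : Type*) [Field E] [CharP E p]
    (k : ℕ) (hk : 1 ≤ k) (hk2 : p = 2 → 2 ≤ k)
    (M : Type*) [AddCommGroup M] [Module E⸨X⸩ M] [Module.Finite E⸨X⸩ M]
    [TopologicalSpace M] [IsModuleTopology E⸨X⸩ M]
    [DistribMulAction (SuperHolder.Gam p k) M] [ContinuousSMul (SuperHolder.Gam p k) M]
    (hM : SuperHolder.IsSemilinear p E k M) :
    -- a stable lattice exists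
    (∃ b : Module.Basis (Fin (Module.finrank E⸨X⸩ M)) E⸨X⸩ M, SuperHolder.IsGood p k b) ∧
    -- and for every choice of a stable lattice, with the valuations that it defines:
    ∀ b : Module.Basis (Fin (Module.finrank E⸨X⸩ M)) E⸨X⸩ M, SuperHolder.IsGood p k b →
      -- (1) if `M` is super-Hölder, then `M = M^{Γ_k-sh, k - m₀}` for some `m₀`, for any such `m₀`
      -- we have `(Ẽ ⊗ M)^{Γ_k-sh, k - m} = 𝐄_m ⊗ M` for all `m ≥ m₀`, and `(Ẽ ⊗ M)^sh = 𝐄_∞ ⊗ M`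
      (SuperHolder.modSh p k hk b = Set.univ →
        (∃ m₀ : ℕ, SuperHolder.modShLevel p k hk b ((k : ℝ) - m₀) = Set.univ) ∧
        (∀ m₀ : ℕ, SuperHolder.modShLevel p k hk b ((k : ℝ) - m₀) = Set.univ →
          ∀ m : ℕ, m₀ ≤ m → SuperHolder.tensorShLevel p k hk hM b ((k : ℝ) - m) =
            SuperHolder.subTensor p M (SuperHolder.Elevel p E m)) ∧
        SuperHolder.tensorSh p k hk hM b =
          SuperHolder.subTensor p M (SuperHolder.Einfty p E)) ∧
      -- (2) if `M` is a `(φ,Γ)`-module, then `(Ẽ ⊗ M)^{Γ_k-sh, k - m} = 𝐄_m ⊗ M` for all `m ≥ 0`,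
      -- and `(Ẽ ⊗ M)^sh = 𝐄_∞ ⊗ M`
      (∀ phiM : M →+ M, SuperHolder.IsPhiGamma (E := E) p k phiM →
        (∀ m : ℕ, SuperHolder.tensorShLevel p k hk hM b ((k : ℝ) - m) =
          SuperHolder.subTensor p M (SuperHolder.Elevel p E m)) ∧
        SuperHolder.tensorSh p k hk hM b =
          SuperHolder.subTensor p M (SuperHolder.Einfty p E)) := by
  refine ⟨SuperHolder.exists_isGood hk hM, fun b hb => ⟨fun hsh => ?_, fun phiM hphi => ?_⟩⟩
  · obtain ⟨m₀, hm₀⟩ := SuperHolder.exists_modShLevel_eq_univ (hM := hM) hsh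
    exact ⟨⟨m₀, hm₀⟩, fun m₀ h m hm => SuperHolder.tensorShLevel_eq hm h,
      SuperHolder.tensorSh_eq hm₀⟩
  · obtain ⟨Q, hQ⟩ := SuperHolder.exists_eq_sum_smul_of_isUnit_toMatrix (hphi.invertible b)
    have h := SuperHolder.modShLevel_eq_univ_of_phi hk hM hb hphi.semilinear hphi.commutes hQ
    exact ⟨fun m => SuperHolder.tensorShLevel_eq (Nat.zero_le m) h, SuperHolder.tensorSh_eq h⟩
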